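/- Consider one continuous-variable mode with Hilbert space $L^2(\mathbb R)$, position operator $q$ and momentum operator $p=-i\,d/dy$. The symplectic tomogram of a state $\rho$ in the direction $(\mu,\nu)\neq(0,0)$ is the probability density $\mathcal W(x|\mu,\nu)=\mathrm{tr}[\rho\,\delta(x-\mu q-\nu p)]$ of the outcome of a measurement of the quadrature $\mu q+\nu p$, that is, the nonnegative integrable function with $\int \mathcal W(x|\mu,\nu)e^{itx}\,dx=\mathrm{tr}\,(\rho\, e^{it(\mu q+\nu p)})$ for all $t\in\mathbb R$; the tomogram of a self-adjoint operator is defined by the same relation. There is an absolute constant $c>0$ with the following property. Let $\rho$ be any state (density operator), $(\mu,\nu)\ne(0,0)$ any direction, $K$ any kernel that is a probability density on $\mathbb R$, $h>0$ any (deterministic) bandwidth and $n\ge 1$. Let $X_1,\dots,X_n$ be the independent outcomes of measuring $\mu q+\nu p$ on $n$ copies of $\rho$, so that they are i.i.d. with density $\mathcal W(\cdot|\mu,\nu)$, and let $$\widehat{\mathcal W}_{nh}(x)=\frac1{nh}\sum_{l=1}^n K\Big(\frac{x-X_l}{h}\Big)$$ be the kernel density estimate (KDE) of the tomogram. Let $\hat\rho$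 be any random state (or, more generally, any random self-adjoint operator) whose tomogram in the direction $(\mu,\nu)$ is, almost surely, $\widehat{\mathcal W}_{nh}$. If $\hat\rho$ estimates $\rho$ with precision $\varepsilon>0$ in trace distance, i.e. $\mathbb E\big[\tfrac12\|\hat\rho-\rho\|_1\big]\le\varepsilon$, then $$n\ \ge\ c\,\varepsilon^{-5/2}.$$ In other words, the number of copies needed to estimate an unknown state by the KDE method to precision $\varepsilon$ in trace distance scales at least as $\varepsilon^{-5/2}$. -/

import Mathlib

open MeasureTheory ProbabilityTheory
open scoped ENNReal ComplexInnerProductSpace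

noncomputable section

/-! ### Traces of operators and trace distance -/

section Trace

variable {H : Type*} [NormedAddCommGroup H] [InnerProductSpace ℂ H] [CompleteSpace H]

/-- The index set of a fixed Hilbert basis of `H`. -/
def traceIndex (H : Type*) [NormedAddCommGroup H] [InnerProductSpace ℂ H] [CompleteSpace H] :
    Set H :=
  (exists_hilbertBasis ℂ H).choose

/-- A fixed Hilbert basis of `H`, along which traces are computed. The trace of a positive or of
a trace-class operator does not depend on this choice. -/
def traceBasis (H : Type*) [NormedAddCommGroup H] [InnerProductSpace ℂ H] [CompleteSpace H] :
    HilbertBasis (traceIndex H) ℂ H :=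
  (exists_hilbertBasis ℂ H).choose_spec.choose

/-- The trace `tr A = ∑ᵢ ⟨eᵢ, A eᵢ⟩` of a trace-class operator. -/
def opTrace (A : H →L[ℂ] H) : ℂ :=
  ∑' i, ⟪traceBasis H i, A (traceBasis H i)⟫

/-- The trace in `[0, ∞]` of a positive operator. -/
def posTrace (A : H →L[ℂ] H) : ℝ≥0∞ :=
  ∑' i, ENNReal.ofReal (⟪traceBasis H i, A (traceBasis H i)⟫).re

/-- The trace norm `‖A‖₁ = tr |A|`, where `|A| = (A* A)^{1/2}`; it is `∞` if `A` is not trace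
class. -/
def traceNorm (A : H →L[ℂ] H) : ℝ≥0∞ :=
  posTrace (CFC.abs A)

/-- The trace distance `D(ρ, σ) = ½ ‖ρ - σ‖₁`. -/
def traceDist (ρ σ : H →L[ℂ] H) : ℝ≥0∞ :=
  traceNorm (ρ - σ) / 2

/-- Density operators: positive semidefinite (in particular self-adjoint), of unit trace. -/
structure IsDensityOperator (ρ : H →L[ℂ] H) : Prop where
  pos : ρ.IsPositive
  trace_eq_one : posTrace ρ = 1

end Trace

/-! ### Quadratures of one mode and symplectic tomograms -/

/-- The Hilbert space `L²(ℝ)` of one continuous-variable mode (position representation). -/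
abbrev ModeSpace : Type := Lp ℂ 2 (volume : Measure ℝ)

/-- The phase `e^{i(tμy + t²μν/2)}` -/
def quadPhase (μ ν t y : ℝ) : ℂ :=
  Complex.exp (((t * μ * y + t ^ 2 * μ * ν / 2 : ℝ) : ℂ) * Complex.I)

theorem norm_quadPhase (μ ν t y : ℝ) : ‖quadPhase μ ν t y‖ = 1 :=
  Complex.norm_exp_ofReal_mul_I _

theorem continuous_quadPhase (μ ν t : ℝ) : Continuous (quadPhase μ ν t) := by
  unfold quadPhase
  fun_prop

theorem measurePreserving_add_const (a : ℝ) :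
    MeasurePreserving (fun y : ℝ => y + a) volume volume :=
  measurePreserving_add_right volume a

theorem memLp_quadPhase_mul (μ ν t : ℝ) (ψ : ModeSpace) :
    MemLp (fun y : ℝ => quadPhase μ ν t y * ψ (y + t * ν)) 2 volume := by
  have h : MemLp (fun y : ℝ => ψ (y + t * ν)) 2 volume :=
    (Lp.memLp ψ).comp_measurePreserving (measurePreserving_add_const (t * ν))
  refine h.of_le ((continuous_quadPhase μ ν t).aestronglyMeasurable.mul h.1) ?_
  filter_upwards with y
  simp [norm_quadPhase]

/-- The unitary operator `e^{i t (μ q + ν p)}` on `L²(ℝ)`, where `q` is multiplication by the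
coordinate `y` and `p = -i d/dy` (so `ħ = 1`):
`(e^{i t (μ q + ν p)} ψ)(y) = e^{i (t μ y + t² μ ν / 2)} ψ(y + t ν)`. -/
def quadExp (μ ν t : ℝ) : ModeSpace →L[ℂ] ModeSpace :=
  LinearMap.mkContinuous
    { toFun := fun ψ => (memLp_quadPhase_mul μ ν t ψ).toLp _
      map_add' := by
        intro ψ φ
        rw [← MemLp.toLp_add]
        refine (MemLp.toLp_eq_toLp_iff _ _).2 ?_
        have h := (measurePreserving_add_const (t * ν)).quasiMeasurePreserving.ae
          (Lp.coeFn_add ψ φ)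
        filter_upwards [h] with y hy
        simp only [Pi.add_apply] at hy ⊢
        rw [hy, mul_add]
      map_smul' := by
        intro c ψ
        rw [RingHom.id_apply, ← MemLp.toLp_const_smul]
        refine (MemLp.toLp_eq_toLp_iff _ _).2 ?_
        have h := (measurePreserving_add_const (t * ν)).quasiMeasurePreserving.ae
          (Lp.coeFn_smul c ψ)
        filter_upwards [h] with y hy
        simp only [Pi.smul_apply, smul_eq_mul] at hy ⊢
        rw [hy]
        ring }
    1 (by
      intro ψ
      have h : MemLp (fun y : ℝ => ψ (y + t * ν)) 2 volume :=
        (Lp.memLp ψ).comp_measurePreserving (measurePreserving_add_const (t * ν))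
      have e : eLpNorm (fun y : ℝ => quadPhase μ ν t y * ψ (y + t * ν)) 2 volume
          = eLpNorm ψ 2 volume := by
        rw [← eLpNorm_comp_measurePreserving (Lp.aestronglyMeasurable ψ)
          (measurePreserving_add_const (t * ν))]
        refine eLpNorm_congr_norm_ae ?_
        filter_upwards with y
        simp [norm_quadPhase]
      simp only [LinearMap.coe_mk, AddHom.coe_mk, Lp.norm_toLp, one_mul]
      rw [e, Lp.norm_def])

/-- `W` is the symplectic tomogram `x ↦ W(x|μ,ν) = tr[ρ δ(x - μ q - ν p)]` of `ρ` in the direction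
`(μ, ν)`: a nonnegative integrable function whose Fourier transform is
`∫ W(x) e^{itx} dx = tr(ρ e^{it(μq+νp)})` for all `t`; this is the definition
`δ(A) = (2π)⁻¹ ∫ e^{ikA} dk` after Fourier inversion in `x`. It determines `W` up to null sets. -/
structure IsTomogram (ρ : ModeSpace →L[ℂ] ModeSpace) (μ ν : ℝ) (W : ℝ → ℝ) : Prop where
  nonneg : ∀ᵐ x, 0 ≤ W x
  integrable : Integrable W
  fourier : ∀ t : ℝ,
    ∫ x : ℝ, (W x : ℂ) * Complex.exp (((t * x : ℝ) : ℂ) * Complex.I)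
      = opTrace (ρ ∘L quadExp μ ν t)

/-! ### Kernel density estimation -/

/-- A smoothing kernel that is a probability density function. -/
structure IsDensityKernel (K : ℝ → ℝ) : Prop where
  measurable : Measurable K
  nonneg : ∀ x, 0 ≤ K x
  integrable : Integrable K
  integral_eq_one : ∫ x, K x = 1

/-- The kernel density estimate `x ↦ (nh)⁻¹ ∑ₗ K((x - Xₗ)/h)`. -/
def kde (K : ℝ → ℝ) (h : ℝ) {n : ℕ} (X : Fin n → ℝ) (x : ℝ) : ℝ :=
  (1 / (n * h)) * ∑ l, K ((x - X l) / h)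

end

/-! The quantum problem reduces to a classical one. Measuring a quadrature contracts distances:
`ofReal_integral_abs_le_traceNorm` bounds the `L¹` distance of two tomograms by the trace norm of
the difference of the operators. It remains to show that a kernel estimate with a nonnegative
kernel, at any bandwidth, has expected `L¹` error `e` only if `n ≥ c e^{-5/2}`
(`card_sample_ge_of_expected_error`). Let `μ` be the law of one observation and `κ` the rescaled
kernel law.

Bias. By Jensen, smoothing by `κ` moves `μ` by at most `e`, tested on functions bounded by `1`. Let
`w` be the length at which `κ` spreads its mass (`exists_length_scale`), and let `G x` be the
`μ`-mass of `[x, x + w)`. Testing on a suitable average of windows shows that `G` is nearly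
invariant in `L²` under typical shifts drawn from `κ`. Positivity of `κ` enters here: the energies
`‖G - τ_y G‖²` are averaged with nonnegative weights, so nothing cancels. Two typical shifts differ
by at least `w`, hence `G` is nearly invariant under some shift `z ≥ w`. Along an orbit of step `z`
the windows are disjoint, with total mass at most `1`, so a Nash-type inequality forces `G ≤ 256 √e`
(`windowMass_le_of_bias`).

Fluctuations. Thus `μ` is spread over at least about `1/√e` cells of length comparable to `w`. The
smoothed empirical mass of a cell still fluctuates, since `κ` is concentrated at scale `2w`. A
fourth-moment argument bounds the summed relative fluctuation below by a constant times `(1 + n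
√e)^{-1/2}`. This is at most a multiple of `e`, which gives `n √e ≳ e^{-2}`. -/

/-! ### Trace duality. -/

section TraceBounds

variable {H : Type*} [NormedAddCommGroup H] [InnerProductSpace ℂ H] [CompleteSpace H]

omit [CompleteSpace H] in
theorem HilbertBasis.tsum_ofReal_norm_inner_sq {ι : Type*} (b : HilbertBasis ι ℂ H) (x : H) :
    ∑' i, ENNReal.ofReal (‖⟪b i, x⟫‖ ^ 2) = ENNReal.ofReal (‖x‖ ^ 2) := by
  have h := b.hasSum_inner_mul_inner x x
  have h' : HasSum (fun i => ‖⟪b i, x⟫‖ ^ 2) (‖x‖ ^ 2) := by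
    have h2 := Complex.hasSum_re h
    convert h2 using 1
    · funext i
      rw [← inner_conj_symm x (b i), Complex.conj_mul', ← Complex.ofReal_pow, Complex.ofReal_re]
    · exact (inner_self_eq_norm_sq (𝕜 := ℂ) x).symm
  rw [← ENNReal.ofReal_tsum_of_nonneg (fun i => by positivity) h'.summable, h'.tsum_eq]

/-- The Hilbert–Schmidt norm of an operator equals that of its adjoint. -/
theorem HilbertBasis.tsum_norm_sq_adjoint {ι : Type*} (b : HilbertBasis ι ℂ H) (A : H →L[ℂ] H) :
    ∑' i, ENNReal.ofReal (‖A.adjoint (b i)‖ ^ 2) = ∑' i, ENNReal.ofReal (‖A (b i)‖ ^ 2) := by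
  simp_rw [← b.tsum_ofReal_norm_inner_sq (A _), ← b.tsum_ofReal_norm_inner_sq (A.adjoint _)]
  rw [ENNReal.tsum_comm]
  refine tsum_congr fun i => tsum_congr fun j => ?_
  rw [ContinuousLinearMap.adjoint_inner_right, norm_inner_symm]

theorem exists_selfAdjoint_sq_eq {P : H →L[ℂ] H} (hP : 0 ≤ P) :
    ∃ S : H →L[ℂ] H, S.adjoint = S ∧ S ∘L S = P :=
  ⟨CFC.sqrt P, (ContinuousLinearMap.star_eq_adjoint _).symm.trans
    (CFC.sqrt_nonneg P).isSelfAdjoint, CFC.sqrt_mul_sqrt_self P hP⟩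

theorem posTrace_eq_tsum_norm_sq {P S : H →L[ℂ] H} (hS : S.adjoint = S) (hSP : S ∘L S = P) :
    posTrace P = ∑' i, ENNReal.ofReal (‖S (traceBasis H i)‖ ^ 2) := by
  refine tsum_congr fun i => ?_
  rw [← hSP, ContinuousLinearMap.comp_apply, ← ContinuousLinearMap.adjoint_inner_left, hS,
    ← inner_self_eq_norm_sq (𝕜 := ℂ)]
  rfl

/-- With `P = S²`, the diagonal entry is `⟪S eᵢ, S B eᵢ⟫`, bounded by half the sum of the squared
norms of `S eᵢ` and `S B eᵢ`. Both families sum to at most `tr P`; for the second one passes to the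
adjoint `B* S`, where the contraction acts last. -/
theorem tsum_norm_inner_comp_le {P B : H →L[ℂ] H} (hP : 0 ≤ P) (hB : ‖B‖ ≤ 1) :
    ∑' i, ENNReal.ofReal ‖⟪traceBasis H i, (P ∘L B) (traceBasis H i)⟫‖ ≤ posTrace P := by
  obtain ⟨S, hS, hSP⟩ := exists_selfAdjoint_sq_eq hP
  have key : ∑' i, ENNReal.ofReal (‖(S ∘L B) (traceBasis H i)‖ ^ 2) ≤ posTrace P := by
    rw [← HilbertBasis.tsum_norm_sq_adjoint, posTrace_eq_tsum_norm_sq hS hSP,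
      ContinuousLinearMap.adjoint_comp, hS]
    refine ENNReal.tsum_le_tsum fun i => ENNReal.ofReal_le_ofReal ?_
    gcongr
    refine (B.adjoint.le_opNorm _).trans ?_
    have : ‖B.adjoint‖ ≤ 1 := by simpa using hB
    exact mul_le_of_le_one_left (norm_nonneg _) this
  have h2 : 2 * ∑' i, ENNReal.ofReal ‖⟪traceBasis H i, (P ∘L B) (traceBasis H i)⟫‖
      ≤ 2 * posTrace P := by
    rw [← ENNReal.tsum_mul_left]
    calc ∑' i, 2 * ENNReal.ofReal ‖⟪traceBasis H i, (P ∘L B) (traceBasis H i)⟫‖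
        ≤ ∑' i, (ENNReal.ofReal (‖S (traceBasis H i)‖ ^ 2)
          + ENNReal.ofReal (‖(S ∘L B) (traceBasis H i)‖ ^ 2)) := by
          refine ENNReal.tsum_le_tsum fun i => ?_
          rw [← ENNReal.ofReal_add (by positivity) (by positivity),
            show (2 : ℝ≥0∞) = ENNReal.ofReal 2 by simp, ← ENNReal.ofReal_mul (by norm_num)]
          refine ENNReal.ofReal_le_ofReal ?_
          have h1 : ‖⟪traceBasis H i, (P ∘L B) (traceBasis H i)⟫‖
              ≤ ‖S (traceBasis H i)‖ * ‖(S ∘L B) (traceBasis H i)‖ := by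
            rw [← hSP, ContinuousLinearMap.comp_assoc, ContinuousLinearMap.comp_apply,
              ← ContinuousLinearMap.adjoint_inner_left, hS]
            exact norm_inner_le_norm _ _
          nlinarith [two_mul_le_add_sq ‖S (traceBasis H i)‖ ‖(S ∘L B) (traceBasis H i)‖]
      _ ≤ posTrace P + posTrace P := by
          rw [ENNReal.tsum_add, ← posTrace_eq_tsum_norm_sq hS hSP]
          gcongr
      _ = 2 * posTrace P := (two_mul _).symm
  exact (ENNReal.mul_le_mul_iff_right (by norm_num) (by norm_num)).1 h2

/-- Trace duality `∑ᵢ |⟨eᵢ, T B eᵢ⟩| ≤ ‖T‖₁` for self-adjoint `T` and a contraction `B`. -/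
theorem tsum_norm_inner_comp_le_traceNorm {T B : H →L[ℂ] H} (hT : IsSelfAdjoint T)
    (hB : ‖B‖ ≤ 1) :
    ∑' i, ENNReal.ofReal ‖⟪traceBasis H i, (T ∘L B) (traceBasis H i)⟫‖ ≤ traceNorm T := by
  have h1 := tsum_norm_inner_comp_le (CFC.posPart_nonneg T) hB
  have h2 := tsum_norm_inner_comp_le (CFC.negPart_nonneg T) hB
  have h3 : traceNorm T = posTrace (T⁺) + posTrace (T⁻) := by
    unfold traceNorm posTrace
    rw [← CFC.posPart_add_negPart T hT, ← ENNReal.tsum_add]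
    refine tsum_congr fun i => ?_
    have hp := ((ContinuousLinearMap.nonneg_iff_isPositive _).1
      (CFC.posPart_nonneg T)).inner_nonneg_right (traceBasis H i)
    have hn := ((ContinuousLinearMap.nonneg_iff_isPositive _).1
      (CFC.negPart_nonneg T)).inner_nonneg_right (traceBasis H i)
    rw [← ENNReal.ofReal_add (Complex.le_def.1 hp).1 (Complex.le_def.1 hn).1,
      _root_.add_apply, inner_add_right, Complex.add_re]
  rw [h3]
  refine le_trans ?_ (add_le_add h1 h2)
  rw [← ENNReal.tsum_add]
  refine ENNReal.tsum_le_tsum fun i => ?_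
  rw [← ENNReal.ofReal_add (norm_nonneg _) (norm_nonneg _)]
  refine ENNReal.ofReal_le_ofReal ?_
  conv_lhs => rw [← CFC.posPart_sub_negPart T hT]
  rw [ContinuousLinearMap.sub_comp, _root_.sub_apply, inner_sub_right]
  exact norm_sub_le _ _

theorem summable_inner_comp {T B : H →L[ℂ] H} (hT : IsSelfAdjoint T) (hB : ‖B‖ ≤ 1)
    (hfin : traceNorm T ≠ ∞) :
    Summable fun i => ⟪traceBasis H i, (T ∘L B) (traceBasis H i)⟫ := by
  refine Summable.of_norm (.of_nnnorm ?_)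
  rw [← ENNReal.tsum_coe_ne_top_iff_summable]
  refine ne_top_of_le_ne_top hfin (le_trans (le_of_eq ?_)
    (tsum_norm_inner_comp_le_traceNorm hT hB))
  refine tsum_congr fun i => ?_
  rw [ofReal_norm, ← enorm_norm]; rfl

theorem ofReal_norm_opTrace_comp_le {T B : H →L[ℂ] H} (hT : IsSelfAdjoint T) (hB : ‖B‖ ≤ 1) :
    ENNReal.ofReal ‖opTrace (T ∘L B)‖ ≤ traceNorm T := by
  by_cases hfin : traceNorm T = ∞
  · rw [hfin]; exact le_top
  refine le_trans ?_ (tsum_norm_inner_comp_le_traceNorm hT hB)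
  have hs := (summable_inner_comp hT hB hfin).norm
  rw [← ENNReal.ofReal_tsum_of_nonneg (fun i => norm_nonneg _) hs]
  exact ENNReal.ofReal_le_ofReal (norm_tsum_le_tsum_norm hs)

/-- `opTrace` is a `tsum`, hence additive only on summable families. The operator `σ` is not assumed
trace class; its diagonal is summed by splitting it into those of `σ - ρ` and `ρ`. -/
theorem opTrace_sub_comp {ρ σ B : H →L[ℂ] H} (hσ : IsSelfAdjoint σ) (hρ : IsSelfAdjoint ρ)
    (hB : ‖B‖ ≤ 1) (hfin : traceNorm ρ ≠ ∞) (hfin' : traceNorm (σ - ρ) ≠ ∞) :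
    opTrace (σ ∘L B) - opTrace (ρ ∘L B) = opTrace ((σ - ρ) ∘L B) := by
  have h1 := summable_inner_comp hρ hB hfin
  have h2 := summable_inner_comp (hσ.sub hρ) hB hfin'
  have h3 : opTrace (σ ∘L B) = opTrace ((σ - ρ) ∘L B) + opTrace (ρ ∘L B) := by
    unfold opTrace
    rw [← h2.tsum_add h1]
    refine tsum_congr fun i => ?_
    rw [ContinuousLinearMap.sub_comp, _root_.sub_apply, inner_sub_right]
    ring
  rw [h3]; ring

theorem IsDensityOperator.traceNorm_ne_top {ρ : H →L[ℂ] H} (h : IsDensityOperator ρ) :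
    traceNorm ρ ≠ ∞ := by
  unfold traceNorm
  rw [CFC.abs_of_nonneg ρ ((ContinuousLinearMap.nonneg_iff_isPositive _).2 h.pos),
    h.trace_eq_one]
  exact ENNReal.one_ne_top

/-- Linearity of `B ↦ tr (T B)` on finite combinations of contractions. -/
theorem opTrace_comp_sum {T : H →L[ℂ] H} (hT : IsSelfAdjoint T) (hfin : traceNorm T ≠ ∞)
    {ι : Type*} (s : Finset ι) (c : ι → ℂ) (B : ι → H →L[ℂ] H) (hB : ∀ k, ‖B k‖ ≤ 1) :
    opTrace (T ∘L ∑ k ∈ s, c k • B k) = ∑ k ∈ s, c k * opTrace (T ∘L B k) := by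
  unfold opTrace
  simp_rw [← tsum_mul_left]
  rw [← Summable.tsum_finsetSum
    (fun k _ => (summable_inner_comp hT (hB k) hfin).mul_left (c k))]
  refine tsum_congr fun i => ?_
  simp only [ContinuousLinearMap.comp_apply, _root_.sum_apply, map_sum,
    _root_.smul_apply, map_smul, inner_sum, inner_smul_right]

end TraceBounds

/-! ### Laurent polynomials of a unitary, and the quadrature group. -/

/-- The von Neumann bound for Laurent polynomials of a unitary element of a C⋆-algebra. -/
theorem norm_sum_smul_zpow_le {A : Type*} [CStarAlgebra A] (u : unitary A) (s : Finset ℤ)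
    (c : ℤ → ℂ) (C : ℝ) (hC : ∀ z : Circle, ‖∑ k ∈ s, c k * (z : ℂ) ^ k‖ ≤ C) :
    ‖∑ k ∈ s, c k • ((u ^ k : unitary A) : A)‖ ≤ C := by
  have hC0 : 0 ≤ C := (norm_nonneg _).trans (hC 1)
  have hsp : ∀ x ∈ spectrum ℂ (u : A), x ∈ Metric.sphere (0 : ℂ) 1 := fun x hx =>
    spectrum.subset_circle_of_unitary u.2 hx
  have hne : ∀ x ∈ spectrum ℂ (u : A), x ≠ 0 := by
    intro x hx h0
    have := hsp x hx
    simp [h0] at this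
  have hcont : ∀ k : ℤ, ContinuousOn (fun x : ℂ => x ^ k) (spectrum ℂ (u : A)) := fun k =>
    ContinuousOn.zpow₀ continuousOn_id k fun x hx => Or.inl (hne x hx)
  have hn : IsStarNormal (u : A) := inferInstance
  have hz : ∀ k : ℤ, cfc (fun x : ℂ => x ^ k) (u : A) = ((u ^ k : unitary A) : A) := by
    intro k
    have := cfc_zpow (R := ℂ) (Unitary.toUnits u) k hn
    rw [← map_zpow] at this
    exact this
  have : ∑ k ∈ s, c k • ((u ^ k : unitary A) : A)
      = cfc (∑ k ∈ s, fun x : ℂ => c k • x ^ k) (u : A) := by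
    rw [cfc_sum (fun k : ℤ => fun x : ℂ => c k • x ^ k) (u : A) s
      (fun k _ => (hcont k).const_smul (c k))]
    refine Finset.sum_congr rfl fun k _ => ?_
    rw [cfc_smul (c k) (fun x : ℂ => x ^ k) (u : A) (hcont k), hz]
  rw [this]
  refine norm_cfc_le hC0 fun x hx => ?_
  simpa using hC ⟨x, mem_sphere_zero_iff_norm.2 (by simpa using hsp x hx)⟩

section QuadratureGroup

theorem quadExp_coeFn (μ ν t : ℝ) (ψ : ModeSpace) :
    quadExp μ ν t ψ =ᵐ[volume] fun y => quadPhase μ ν t y * ψ (y + t * ν) :=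
  MemLp.coeFn_toLp (memLp_quadPhase_mul μ ν t ψ)

theorem norm_quadExp_apply (μ ν t : ℝ) (ψ : ModeSpace) : ‖quadExp μ ν t ψ‖ = ‖ψ‖ := by
  rw [Lp.norm_def, Lp.norm_def, eLpNorm_congr_ae (quadExp_coeFn μ ν t ψ),
    ← eLpNorm_comp_measurePreserving (Lp.aestronglyMeasurable ψ)
      (measurePreserving_add_const (t * ν))]
  congr 1
  refine eLpNorm_congr_norm_ae ?_
  filter_upwards with y
  simp [norm_quadPhase]

/-- Translating by `s ν` before applying the second phase produces the cross term `s t μ ν`, which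
completes the quadratic phases to `(s + t)² μ ν / 2`. -/
theorem quadExp_comp (μ ν s t : ℝ) :
    quadExp μ ν s ∘L quadExp μ ν t = quadExp μ ν (s + t) := by
  refine ContinuousLinearMap.ext fun ψ => Lp.ext ?_
  have h1 := quadExp_coeFn μ ν s (quadExp μ ν t ψ)
  have h2 := (measurePreserving_add_const (s * ν)).quasiMeasurePreserving.ae
    (quadExp_coeFn μ ν t ψ)
  filter_upwards [h1, h2, quadExp_coeFn μ ν (s + t) ψ] with y h1 h2 h3
  rw [ContinuousLinearMap.comp_apply, h1, h2, h3, ← mul_assoc,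
    show y + s * ν + t * ν = y + (s + t) * ν by ring]
  congr 1
  unfold quadPhase
  rw [← Complex.exp_add]
  congr 1
  push_cast
  ring

theorem quadExp_zero (μ ν : ℝ) : quadExp μ ν 0 = 1 := by
  refine ContinuousLinearMap.ext fun ψ => Lp.ext ?_
  filter_upwards [quadExp_coeFn μ ν 0 ψ] with y h
  rw [h]
  simp [quadPhase]

theorem quadExp_mem_unitary (μ ν t : ℝ) :
    quadExp μ ν t ∈ unitary (ModeSpace →L[ℂ] ModeSpace) := by
  have h1 : star (quadExp μ ν t) * quadExp μ ν t = 1 :=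
    (ContinuousLinearMap.norm_map_iff_adjoint_comp_self _).1 (norm_quadExp_apply μ ν t)
  have h2 : quadExp μ ν t * quadExp μ ν (-t) = 1 := by
    have := quadExp_comp μ ν t (-t)
    rwa [add_neg_cancel, quadExp_zero] at this
  have h3 : star (quadExp μ ν t) = quadExp μ ν (-t) := left_inv_eq_right_inv h1 h2
  exact Unitary.mem_iff.2 ⟨h1, by rw [h3, h2]⟩

/-- The one-parameter unitary group `t ↦ e^{it(μq+νp)}`. -/
noncomputable def quadUnitary (μ ν : ℝ) :
    Multiplicative ℝ →* unitary (ModeSpace →L[ℂ] ModeSpace) where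
  toFun t := ⟨quadExp μ ν t.toAdd, quadExp_mem_unitary μ ν t.toAdd⟩
  map_one' := Subtype.ext (quadExp_zero μ ν)
  map_mul' s t := Subtype.ext (quadExp_comp μ ν s.toAdd t.toAdd).symm

theorem quadUnitary_zpow (μ ν t : ℝ) (k : ℤ) :
    ((quadUnitary μ ν (Multiplicative.ofAdd t) ^ k :
      unitary (ModeSpace →L[ℂ] ModeSpace)) : ModeSpace →L[ℂ] ModeSpace)
      = quadExp μ ν (k * t) := by
  rw [← map_zpow, ← ofAdd_zsmul, zsmul_eq_mul]
  rfl

theorem norm_quadExp_le (μ ν t : ℝ) : ‖quadExp μ ν t‖ ≤ 1 :=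
  ContinuousLinearMap.opNorm_le_bound _ zero_le_one fun ψ => by
    rw [norm_quadExp_apply, one_mul]

end QuadratureGroup

/-! ### The `L¹` norm by duality with trigonometric polynomials. -/

section DualL1

theorem Integrable.ofReal_mul_of_continuous {D : ℝ → ℝ} (hD : Integrable D) {v : ℝ → ℂ}
    (hv : Continuous v) {C : ℝ} (hC : ∀ x, ‖v x‖ ≤ C) :
    Integrable fun x => (D x : ℂ) * v x :=
  hD.ofReal.mul_bdd (c := C) hv.aestronglyMeasurable (.of_forall hC)

/-- Both sides are continuous in `v` for the sup norm, so the inequality passes from trigonometric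
polynomials to their closure, which is everything. -/
theorem AddCircle.norm_integral_mul_le_of_fourier {D : ℝ → ℝ} (hD : Integrable D) {τ : ℝ}
    [hτ : Fact (0 < τ)] {N : ℝ}
    (h : ∀ c : ℤ →₀ ℂ, ‖∫ x : ℝ, (D x : ℂ) * c.sum (fun k a => a * fourier k (x : AddCircle τ))‖
      ≤ N * ‖c.sum (fun k a => a • (fourier k : C(AddCircle τ, ℂ)))‖)
    (v : C(AddCircle τ, ℂ)) : ‖∫ x : ℝ, (D x : ℂ) * v (x : AddCircle τ)‖ ≤ N * ‖v‖ := by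
  have hcont : Continuous fun v : C(AddCircle τ, ℂ) =>
      ∫ x : ℝ, (D x : ℂ) * v (x : AddCircle τ) := by
    refine continuous_iff_continuousAt.2 fun v₀ => ?_
    refine continuousAt_of_dominated (bound := fun x => ‖D x‖ * (‖v₀‖ + 1)) ?_ ?_ ?_ ?_
    · refine .of_forall fun v => ?_
      exact hD.ofReal.aestronglyMeasurable.mul
        (v.continuous.comp (AddCircle.continuous_mk' τ)).aestronglyMeasurable
    · have : ∀ᶠ v in nhds v₀, ‖v‖ < ‖v₀‖ + 1 :=
        continuous_norm.continuousAt.eventually_lt continuousAt_const (by simp)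
      filter_upwards [this] with v hv
      filter_upwards with x
      rw [norm_mul, Complex.norm_real]
      gcongr
      exact (v.norm_coe_le_norm _).trans hv.le
    · exact hD.norm.mul_const _
    · filter_upwards with x
      exact (continuous_const.mul (continuous_eval_const (F := C(AddCircle τ, ℂ)) _)).continuousAt
  have hcl : IsClosed {v : C(AddCircle τ, ℂ) |
      ‖∫ x : ℝ, (D x : ℂ) * v (x : AddCircle τ)‖ ≤ N * ‖v‖} :=
    isClosed_le hcont.norm (continuous_const.mul continuous_norm)
  have hmem : v ∈ (Submodule.span ℂ (Set.range <| @fourier τ)).topologicalClosure := by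
    rw [span_fourier_closure_eq_top]; trivial
  refine hcl.closure_subset_iff.2 ?_ hmem
  intro p hp
  obtain ⟨c, rfl⟩ := Finsupp.mem_span_range_iff_exists_finsupp.1 hp
  have := h c
  simp only [Set.mem_ofPred_eq]
  convert this using 5 with x
  simp [Finsupp.sum, ContinuousMap.sum_apply]

/-- A compactly supported `v` is the pointwise limit of its periodisations from `[-(m+1), m+1)`.
These are continuous once `v` vanishes at the endpoints, and remain bounded by `1`. -/
theorem norm_integral_mul_le_of_periodic {D : ℝ → ℝ} (hD : Integrable D) {N : ℝ} (hN : 0 ≤ N)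
    (h : ∀ (τ : ℝ) [Fact (0 < τ)] (v : C(AddCircle τ, ℂ)),
      ‖∫ x : ℝ, (D x : ℂ) * v (x : AddCircle τ)‖ ≤ N * ‖v‖)
    {v : ℝ → ℝ} (hv : Continuous v) (hs : HasCompactSupport v) (hv1 : ∀ x, |v x| ≤ 1) :
    ∫ x, D x * v x ≤ N := by
  obtain ⟨R, hR⟩ := hs.isBounded.subset_closedBall 0
  have hzero : ∀ x, R < |x| → v x = 0 := by
    intro x hx
    refine image_eq_zero_of_notMem_tsupport fun hmem => ?_
    have := hR hmem
    simp only [Metric.mem_closedBall, dist_zero_right, Real.norm_eq_abs] at this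
    linarith
  have hτ : ∀ m : ℕ, Fact (0 < 2 * (m + 1 : ℝ)) := fun m => ⟨by positivity⟩
  let u : ℕ → ℝ → ℂ := fun m x =>
    AddCircle.liftIco (2 * (m + 1 : ℝ)) (-(m + 1 : ℝ)) (fun y => (v y : ℂ)) (x : AddCircle _)
  have hulim : ∀ x, ∀ᶠ m in Filter.atTop, u m x = v x := by
    intro x
    filter_upwards [Filter.eventually_ge_atTop ⌈|x|⌉₊] with m hm
    have hm' : |x| ≤ m := (Nat.le_ceil _).trans (by exact_mod_cast hm)
    have := abs_le.1 hm'
    have := hτ m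
    exact AddCircle.liftIco_coe_apply ⟨by linarith, by linarith⟩
  have hucont : ∀ᶠ m : ℕ in Filter.atTop, Continuous
      (AddCircle.liftIco (2 * (m + 1 : ℝ)) (-(m + 1 : ℝ)) (fun y => (v y : ℂ))) := by
    filter_upwards [Filter.eventually_ge_atTop ⌈|R|⌉₊] with m hm
    have hm' : |R| ≤ m := (Nat.le_ceil _).trans (by exact_mod_cast hm)
    have hR' := le_abs_self R
    have := hτ m
    refine AddCircle.liftIco_continuous ?_ (by fun_prop)
    rw [hzero, hzero]
    · rw [lt_abs]; left; linarith
    · rw [lt_abs]; right; linarith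
  have hub : ∀ (m : ℕ) (z : AddCircle (2 * (m + 1 : ℝ))), ‖AddCircle.liftIco (2 * (m + 1 : ℝ)) (-(m + 1 : ℝ))
      (fun y => (v y : ℂ)) z‖ ≤ 1 := by
    intro m z
    have := hτ m
    have : ∀ y : ℝ, ‖(v y : ℂ)‖ ≤ 1 := fun y => by simpa using hv1 y
    exact this _
  have hlim : Filter.Tendsto (fun m => ∫ x, (D x : ℂ) * u m x) Filter.atTop
      (nhds (∫ x, (D x : ℂ) * v x)) := by
    refine tendsto_integral_filter_of_dominated_convergence (fun x => ‖D x‖) ?_ ?_ hD.norm ?_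
    · filter_upwards [hucont] with m hm
      exact hD.ofReal.aestronglyMeasurable.mul
        (hm.comp (AddCircle.continuous_mk' _)).aestronglyMeasurable
    · refine .of_forall fun m => .of_forall fun x => ?_
      rw [norm_mul, Complex.norm_real]
      exact mul_le_of_le_one_right (norm_nonneg _) (hub _ _)
    · refine .of_forall fun x => ?_
      refine tendsto_const_nhds.mul (tendsto_const_nhds.congr' ?_)
      filter_upwards [hulim x] with m hm using hm.symm
  have hle : ‖∫ x, (D x : ℂ) * v x‖ ≤ N := by
    refine le_of_tendsto hlim.norm ?_
    filter_upwards [hucont] with m hm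
    refine (h (2 * (m + 1 : ℝ)) ⟨_, hm⟩).trans ?_
    refine mul_le_of_le_one_right hN ?_
    exact (ContinuousMap.norm_le _ zero_le_one).2 fun z => hub m z
  have : ∫ x, (D x : ℂ) * v x = ((∫ x, D x * v x : ℝ) : ℂ) := by
    rw [← integral_complex_ofReal]; push_cast; rfl
  rw [this, Complex.norm_real] at hle
  exact (le_abs_self _).trans hle

theorem integral_abs_le_of_forall_compactSupport {D : ℝ → ℝ} (hD : Integrable D) {N : ℝ}
    (h : ∀ v : ℝ → ℝ, Continuous v → HasCompactSupport v → (∀ x, |v x| ≤ 1) →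
      ∫ x, D x * v x ≤ N) : ∫ x, |D x| ≤ N := by
  refine le_of_forall_pos_le_add fun η hη => ?_
  obtain ⟨g, hgs, hgD, hgc, hgi⟩ :=
    hD.exists_hasCompactSupport_integral_sub_le (half_pos hη)
  have hden : ∀ (m : ℕ) x, 0 < 1 + m * |g x| := fun m x => by positivity
  -- A continuous substitute for the sign of `g` with the same compact support: `g * v m` tends to
  -- `|g|`.
  obtain ⟨v, hv⟩ : ∃ v : ℕ → ℝ → ℝ, ∀ m x, v m x = m * g x / (1 + m * |g x|) := ⟨_, fun _ _ => rfl⟩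
  have hvc : ∀ m, Continuous (v m) := fun m => by
    rw [funext (hv m)]
    exact Continuous.div (by fun_prop) (by fun_prop) fun x => (hden m x).ne'
  have hv1 : ∀ m x, |v m x| ≤ 1 := by
    intro m x
    rw [hv, abs_div, abs_of_pos (hden m x), div_le_one (hden m x), abs_mul, Nat.abs_cast]
    linarith
  have hvs : ∀ m, HasCompactSupport (v m) := fun m => by
    rw [funext (hv m)]
    exact hgs.comp_left (g := fun y : ℝ => (m : ℝ) * y / (1 + (m : ℝ) * |y|)) (by simp)
  have hint : ∀ m, Integrable fun x => g x * v m x := fun m =>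
    hgi.mul_bdd (c := 1) (hvc m).aestronglyMeasurable (.of_forall (hv1 m))
  have hint' : ∀ m, Integrable fun x => D x * v m x := fun m =>
    hD.mul_bdd (c := 1) (hvc m).aestronglyMeasurable (.of_forall (hv1 m))
  have hdiff : Integrable fun x => ‖D x - g x‖ := (hD.sub hgi).norm
  have hbd : ∀ m, ∫ x, g x * v m x ≤ N + η / 2 := by
    intro m
    have h1 : ∫ x, g x * v m x ≤ ∫ x, (D x * v m x + ‖D x - g x‖) := by
      refine integral_mono (hint m) ((hint' m).add hdiff) fun x => ?_
      have : (g x - D x) * v m x ≤ ‖D x - g x‖ := by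
        refine (le_abs_self _).trans ?_
        rw [abs_mul, Real.norm_eq_abs, abs_sub_comm]
        exact mul_le_of_le_one_right (abs_nonneg _) (hv1 m x)
      simp only
      linarith
    rw [integral_add (hint' m) hdiff] at h1
    linarith [h (v m) (hvc m) (hvs m) (hv1 m)]
  have hlim : Filter.Tendsto (fun m => ∫ x, g x * v m x) Filter.atTop (nhds (∫ x, |g x|)) := by
    refine tendsto_integral_filter_of_dominated_convergence (fun x => ‖g x‖) ?_ ?_ hgi.norm ?_
    · exact .of_forall fun m => (hint m).aestronglyMeasurable
    · refine .of_forall fun m => .of_forall fun x => ?_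
      rw [norm_mul]
      exact mul_le_of_le_one_right (norm_nonneg _) (hv1 m x)
    · refine .of_forall fun x => ?_
      by_cases hx : g x = 0
      · simp [hx]
      have hx' : 0 < |g x| := abs_pos.2 hx
      have e : ∀ m, g x * v m x = |g x| - |g x| * (1 + m * |g x|)⁻¹ := by
        intro m
        have := (hden m x).ne'
        rw [hv]
        field_simp
        nlinarith [sq_abs (g x)]
      simp_rw [e]
      have : Filter.Tendsto (fun m : ℕ => (1 + m * |g x|)) Filter.atTop Filter.atTop :=
        Filter.tendsto_atTop_add_const_left _ _
          (tendsto_natCast_atTop_atTop.atTop_mul_const hx')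
      simpa using (tendsto_const_nhds (x := |g x|)).sub
        ((tendsto_const_nhds (x := |g x|)).mul this.inv_tendsto_atTop)
  have hg : ∫ x, |g x| ≤ N + η / 2 := le_of_tendsto' hlim hbd
  have hfin : ∫ x, |D x| ≤ ∫ x, (|g x| + ‖D x - g x‖) := by
    refine integral_mono hD.abs (hgi.abs.add hdiff) fun x => ?_
    simp only [Real.norm_eq_abs]
    have := abs_add_le (g x) (D x - g x)
    rwa [add_sub_cancel] at this
  rw [integral_add hgi.abs hdiff] at hfin
  linarith

end DualL1

/-- If `D` is the (signed) tomogram of a self-adjoint operator `T`, then `‖D‖_{L¹} ≤ ‖T‖₁`. -/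
theorem ofReal_integral_abs_le_traceNorm {T : ModeSpace →L[ℂ] ModeSpace} (hT : IsSelfAdjoint T)
    {μ ν : ℝ} {D : ℝ → ℝ} (hD : Integrable D)
    (hF : traceNorm T ≠ ∞ → ∀ t : ℝ,
      ∫ x : ℝ, (D x : ℂ) * Complex.exp (((t * x : ℝ) : ℂ) * Complex.I)
        = opTrace (T ∘L quadExp μ ν t)) :
    ENNReal.ofReal (∫ x, |D x|) ≤ traceNorm T := by
  by_cases hfin : traceNorm T = ∞
  · rw [hfin]; exact le_top
  specialize hF hfin
  rw [ENNReal.ofReal_le_iff_le_toReal hfin]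
  refine integral_abs_le_of_forall_compactSupport hD fun v hv hs hv1 =>
    norm_integral_mul_le_of_periodic hD ENNReal.toReal_nonneg (fun τ hτ w => ?_) hv hs hv1
  refine AddCircle.norm_integral_mul_le_of_fourier hD (fun c => ?_) w
  set p : C(AddCircle τ, ℂ) := c.sum (fun k a => a • (fourier k : C(AddCircle τ, ℂ))) with hp
  -- The characters of period `τ` have frequencies in `δ ℤ`, so they correspond to integer powers of
  -- the single unitary `e^{iδ(μq+νp)}`. The integral of `D` against `p` is then the trace of `T`
  -- times `p` of this unitary, and no spectral theorem for the unbounded quadrature is needed.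
  set δ : ℝ := 2 * Real.pi / τ with hδ
  have hτ0 : τ ≠ 0 := hτ.out.ne'
  have hfour : ∀ (k : ℤ) (x : ℝ), fourier k (x : AddCircle τ)
      = Complex.exp (((k * δ * x : ℝ) : ℂ) * Complex.I) := by
    intro k x
    rw [fourier_coe_apply]
    congr 1
    rw [hδ]
    push_cast
    ring
  have hsum : ∫ x : ℝ, (D x : ℂ) * c.sum (fun k a => a * fourier k (x : AddCircle τ))
      = opTrace (T ∘L ∑ k ∈ c.support, c k • quadExp μ ν (k * δ)) := by
    rw [opTrace_comp_sum hT hfin _ _ _ (fun k => norm_quadExp_le μ ν _)]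
    simp_rw [← hF, Finsupp.sum, Finset.mul_sum, hfour]
    rw [integral_finsetSum]
    · refine Finset.sum_congr rfl fun k _ => ?_
      rw [← integral_const_mul]
      refine integral_congr_ae (.of_forall fun x => ?_)
      simp only
      ring
    · intro k _
      refine Integrable.ofReal_mul_of_continuous hD (by fun_prop) (C := ‖c k‖) fun x => ?_
      rw [norm_mul, Complex.norm_exp_ofReal_mul_I, mul_one]
  have hop : ‖∑ k ∈ c.support, c k • quadExp μ ν (k * δ)‖ ≤ ‖p‖ := by
    have := norm_sum_smul_zpow_le (quadUnitary μ ν (Multiplicative.ofAdd δ)) c.support c ‖p‖ ?_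
    · simpa only [quadUnitary_zpow] using this
    · intro z
      obtain ⟨x, rfl⟩ : ∃ x : AddCircle τ, x.toCircle = z :=
        ⟨_, (AddCircle.homeomorphCircle_apply hτ0 _).symm.trans
          ((AddCircle.homeomorphCircle hτ0).apply_symm_apply z)⟩
      refine le_trans (le_of_eq ?_) (p.norm_coe_le_norm x)
      congr 1
      simp only [hp, Finsupp.sum, ContinuousMap.sum_apply, ContinuousMap.smul_apply,
        fourier_apply, AddCircle.toCircle_zsmul, smul_eq_mul, Circle.coe_zpow]
  rw [hsum]
  rcases eq_or_ne ‖p‖ 0 with h0 | h0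
  · rw [h0] at hop
    rw [norm_le_zero_iff.1 hop, h0]
    simp [opTrace]
  have hscale : ∑ k ∈ c.support, c k • quadExp μ ν (k * δ)
      = (‖p‖ : ℂ) • ((‖p‖ : ℂ)⁻¹ • ∑ k ∈ c.support, c k • quadExp μ ν (k * δ)) := by
    rw [smul_smul, mul_inv_cancel₀ (by exact_mod_cast h0), one_smul]
  set B := (‖p‖ : ℂ)⁻¹ • ∑ k ∈ c.support, c k • quadExp μ ν (k * δ) with hB
  have hB1 : ‖B‖ ≤ 1 := by
    rw [hB, norm_smul, norm_inv, Complex.norm_real, norm_norm]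
    rw [inv_mul_le_iff₀ (by positivity)]
    simpa using hop
  have h1 := ofReal_norm_opTrace_comp_le hT hB1
  rw [ENNReal.ofReal_le_iff_le_toReal hfin] at h1
  have h2 : opTrace (T ∘L ((‖p‖ : ℂ) • B)) = (‖p‖ : ℂ) * opTrace (T ∘L B) := by
    have := opTrace_comp_sum hT hfin {()} (fun _ => (‖p‖ : ℂ)) (fun _ => B) (fun _ => hB1)
    simpa using this
  rw [hscale, h2, norm_mul, Complex.norm_real, norm_norm, mul_comm]
  gcongr

/-! ### Absolute moments of sums of independent bounded variables. -/

section Moments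

variable {Ω : Type*} [MeasurableSpace Ω] {P : Measure Ω} [IsProbabilityMeasure P]

/-- Second and fourth moments of a sum of independent centred variables bounded by `1`. -/
theorem iIndepFun_moments_sum {ι : Type*} {Y : ι → Ω → ℝ} (hm : ∀ i, Measurable (Y i))
    (hb : ∀ i ω, |Y i ω| ≤ 1) (hind : iIndepFun Y P) (h0 : ∀ i, ∫ ω, Y i ω ∂P = 0)
    {v : ℝ} (h2 : ∀ i, ∫ ω, Y i ω ^ 2 ∂P = v) (s : Finset ι) :
    ∫ ω, (∑ i ∈ s, Y i ω) ^ 2 ∂P = s.card * v ∧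
      ∫ ω, (∑ i ∈ s, Y i ω) ^ 4 ∂P ≤ s.card * v + 3 * (s.card * v) ^ 2 := by
  classical
  have hint : ∀ (f : Ω → ℝ), Measurable f → ∀ C : ℝ, (∀ ω, |f ω| ≤ C) → Integrable f P :=
    fun f hf C hC => Integrable.of_bound hf.aestronglyMeasurable C (.of_forall hC)
  have hmean : ∀ s : Finset ι, ∫ ω, ∑ i ∈ s, Y i ω ∂P = 0 := fun s => by
    rw [integral_finsetSum _ fun i _ => hint _ (hm i) 1 (hb i)]
    exact Finset.sum_eq_zero fun i _ => h0 i
  induction s using Finset.induction_on with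
  | empty => simp
  | insert i s his ih =>
    obtain ⟨ih2, ih4⟩ := ih
    set S : Ω → ℝ := fun ω => ∑ j ∈ s, Y j ω with hS
    replace ih2 : ∫ ω, S ω ^ 2 ∂P = s.card * v := ih2
    replace ih4 : ∫ ω, S ω ^ 4 ∂P ≤ s.card * v + 3 * (s.card * v) ^ 2 := ih4
    have hSm : Measurable S := Finset.measurable_fun_sum s fun j _ => hm j
    have hSb : ∀ ω, |S ω| ≤ s.card := fun ω => by
      refine (Finset.abs_sum_le_sum_abs _ _).trans ((Finset.sum_le_sum fun j _ => hb j ω).trans ?_)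
      simp
    have hSY : IndepFun S (Y i) P := by
      have := hind.indepFun_finsetSum_of_notMem hm his
      convert this using 1
      funext ω
      simp [hS]
    have hpow : ∀ a b : ℕ, Integrable (fun ω => S ω ^ a * Y i ω ^ b) P := fun a b =>
      hint _ ((hSm.pow_const a).mul ((hm i).pow_const b)) (s.card ^ a * 1 ^ b) fun ω => by
        rw [abs_mul, abs_pow, abs_pow]
        gcongr
        exacts [hSb ω, hb i ω]
    have hmul : ∀ a b : ℕ, ∫ ω, S ω ^ a * Y i ω ^ b ∂P
        = (∫ ω, S ω ^ a ∂P) * ∫ ω, Y i ω ^ b ∂P := fun a b =>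
      (hSY.comp (φ := fun x => x ^ a) (ψ := fun x => x ^ b) (measurable_id.pow_const a)
        (measurable_id.pow_const b)).integral_fun_mul_eq_mul_integral
        (hSm.pow_const a).aestronglyMeasurable ((hm i).pow_const b).aestronglyMeasurable
    have hS0 : ∫ ω, S ω ∂P = 0 := hmean s
    have hY4 : ∫ ω, Y i ω ^ 4 ∂P ≤ v := by
      rw [← h2 i]
      refine integral_mono (hint _ ((hm i).pow_const 4) 1 fun ω => ?_)
        (hint _ ((hm i).pow_const 2) 1 fun ω => ?_) fun ω => ?_
      · rw [abs_pow]; exact pow_le_one₀ (abs_nonneg _) (hb i ω)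
      · rw [abs_pow]; exact pow_le_one₀ (abs_nonneg _) (hb i ω)
      · have h1 : Y i ω ^ 2 ≤ 1 := by
          rw [← sq_abs]; exact pow_le_one₀ (abs_nonneg _) (hb i ω)
        nlinarith [sq_nonneg (Y i ω)]
    have hv : 0 ≤ v := by rw [← h2 i]; exact integral_nonneg fun ω => sq_nonneg _
    have hcard : ((insert i s).card : ℝ) = s.card + 1 := by
      rw [Finset.card_insert_of_notMem his]; push_cast; rfl
    have e : ∀ ω, ∑ j ∈ insert i s, Y j ω = S ω + Y i ω := fun ω => by
      rw [Finset.sum_insert his, add_comm]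
    simp_rw [e]
    rw [hcard]
    -- In the fourth power the terms `S Y³` and `S³ Y` have mean zero; the term `6 S² Y²` fits into
    -- the growth of `3 (k v)²`.
    have hbin : ∀ n : ℕ, ∫ ω, (S ω + Y i ω) ^ n ∂P = ∑ m ∈ Finset.range (n + 1),
        (∫ ω, S ω ^ m ∂P) * (∫ ω, Y i ω ^ (n - m) ∂P) * n.choose m := fun n => by
      simp_rw [add_pow]
      rw [integral_finsetSum _ fun m _ => (hpow m (n - m)).mul_const _]
      exact Finset.sum_congr rfl fun m _ => by rw [integral_mul_const, hmul]
    constructor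
    · rw [hbin]
      simp [Finset.sum_range_succ, h0, h2, ih2]
      ring
    · rw [hbin]
      simp [Finset.sum_range_succ, h0, h2, ih2, hS0, Nat.choose]
      nlinarith [sq_nonneg v]

/-- A first absolute moment bound from the second and fourth moments. -/
theorem integral_abs_ge_of_moments {Z : Ω → ℝ} (hZ : Measurable Z) {C : ℝ}
    (hC : ∀ ω, |Z ω| ≤ C) {V τ : ℝ} (hτ : 0 < τ) (h2 : ∫ ω, Z ω ^ 2 ∂P = V)
    (h4 : ∫ ω, Z ω ^ 4 ∂P ≤ V * τ ^ 2) :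
    23 / 27 * V / τ ≤ ∫ ω, |Z ω| ∂P := by
  have hint : ∀ k : ℕ, Integrable (fun ω => Z ω ^ k) P := fun k =>
    Integrable.of_bound (hZ.pow_const k).aestronglyMeasurable (C ^ k) (.of_forall fun ω => by
      rw [Real.norm_eq_abs, abs_pow]; exact pow_le_pow_left₀ (abs_nonneg _) (hC ω) k)
  have habs : Integrable (fun ω => |Z ω|) P := by simpa using (hint 1).abs
  -- The constant `4/27` is the least for which `s² - C s⁴ ≤ s` on `s ≥ 0`: there is a double root
  -- at `s = 3/2`. It leaves `23/27 = 1 - 4/27`.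
  have key : ∀ ω, Z ω ^ 2 * τ⁻¹ - Z ω ^ 4 * (4 / 27 * (τ ^ 3)⁻¹) ≤ |Z ω| := by
    intro ω
    have ht := abs_nonneg (Z ω)
    rw [← sq_abs, show Z ω ^ 4 = |Z ω| ^ 4 by rw [← abs_pow]; exact (abs_of_nonneg (by positivity)).symm]
    generalize |Z ω| = t at ht
    have e : t - (t ^ 2 * τ⁻¹ - t ^ 4 * (4 / 27 * (τ ^ 3)⁻¹))
        = t * ((1 - 2 / 3 * (t * τ⁻¹)) ^ 2 * (1 + 1 / 3 * (t * τ⁻¹))) := by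
      field_simp
      ring
    have : 0 ≤ t * ((1 - 2 / 3 * (t * τ⁻¹)) ^ 2 * (1 + 1 / 3 * (t * τ⁻¹))) := by positivity
    linarith
  have h := integral_mono (((hint 2).mul_const τ⁻¹).sub ((hint 4).mul_const _)) habs key
  rw [integral_sub' ((hint 2).mul_const τ⁻¹) ((hint 4).mul_const _), integral_mul_const,
    integral_mul_const, h2] at h
  have h5 : (∫ ω, Z ω ^ 4 ∂P) * (4 / 27 * (τ ^ 3)⁻¹) ≤ V * τ ^ 2 * (4 / 27 * (τ ^ 3)⁻¹) := by
    gcongr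
  have h6 : V * τ ^ 2 * (4 / 27 * (τ ^ 3)⁻¹) = 4 / 27 * V / τ := by field_simp
  have h7 : V * τ⁻¹ - 4 / 27 * V / τ = 23 / 27 * V / τ := by field_simp; ring
  linarith

end Moments

/-! ### The length scale of the kernel, and the energy of window masses. -/

/-- An absolutely continuous probability measure on `ℝ` has a length scale `w`: it charges no
interval of length `w` by more than `3/4`, and some interval of length `2w` by more than `3/4`. -/
theorem exists_length_scale (κ : Measure ℝ) [IsProbabilityMeasure κ] (hκ : κ ≪ volume) :
    ∃ w : ℝ, 0 < w ∧ (∀ x, κ.real (Set.Icc x (x + w)) ≤ 3 / 4) ∧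
      ∃ a, 3 / 4 < κ.real (Set.Icc a (a + 2 * w)) := by
  classical
  obtain ⟨w₀, hw₀, hsmall⟩ : ∃ w : ℝ, 0 < w ∧ ∀ x, κ.real (Set.Icc x (x + w)) ≤ 3 / 4 := by
    have hfin : ∫⁻ x, κ.rnDeriv volume x ≠ ∞ := (Measure.lintegral_rnDeriv_lt_top κ volume).ne
    obtain ⟨δ, hδ, h⟩ := exists_pos_setLIntegral_lt_of_measure_lt hfin
      (ε := ENNReal.ofReal (3 / 4)) (by simp)
    obtain ⟨w, hw, hwδ⟩ : ∃ w : ℝ, 0 < w ∧ ENNReal.ofReal w < δ := by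
      obtain ⟨r, hr, hrδ⟩ := ENNReal.lt_iff_exists_nnreal_btwn.1 hδ
      exact ⟨r, by exact_mod_cast hr, by simpa using hrδ⟩
    refine ⟨w, hw, fun x => ?_⟩
    have h1 := h (Set.Icc x (x + w)) (by simpa using hwδ)
    rw [Measure.setLIntegral_rnDeriv hκ] at h1
    exact ENNReal.toReal_le_of_le_ofReal (by norm_num) h1.le
  -- Starting from a length `w₀` too short by absolute continuity, the length is doubled until some
  -- interval carries mass above `3/4`. The scale sought is the last length before this happens.
  have hex : ∃ k : ℕ, ∃ a, 3 / 4 < κ.real (Set.Icc a (a + 2 ^ k * w₀)) := by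
    have hmono : Monotone fun k : ℕ => Set.Icc (-(k : ℝ)) k := fun i j hij =>
      Set.Icc_subset_Icc (neg_le_neg (by exact_mod_cast hij)) (by exact_mod_cast hij)
    have hU : ⋃ k : ℕ, Set.Icc (-(k : ℝ)) k = Set.univ := by
      refine Set.eq_univ_of_forall fun x => Set.mem_iUnion.2 ?_
      obtain ⟨k, hk⟩ := exists_nat_ge |x|
      exact ⟨k, abs_le.1 hk⟩
    have hlim := tendsto_measure_iUnion_atTop (μ := κ) hmono
    rw [hU, measure_univ] at hlim
    obtain ⟨m, hm⟩ := (hlim.eventually_const_lt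
      (show ENNReal.ofReal (3 / 4) < 1 by rw [← ENNReal.ofReal_one]; exact
        (ENNReal.ofReal_lt_ofReal_iff one_pos).2 (by norm_num))).exists
    obtain ⟨k, hk⟩ := pow_unbounded_of_one_lt (2 * m / w₀) (one_lt_two : (1 : ℝ) < 2)
    rw [div_lt_iff₀ hw₀] at hk
    refine ⟨k, -m, ?_⟩
    have h1 : 3 / 4 < κ.real (Set.Icc (-(m : ℝ)) m) :=
      (ENNReal.ofReal_lt_iff_lt_toReal (by norm_num) (measure_ne_top _ _)).1 hm
    exact h1.trans_le (measureReal_mono (Set.Icc_subset_Icc le_rfl (by linarith)))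
  have hk0 : Nat.find hex ≠ 0 := by
    intro h0
    obtain ⟨a, ha⟩ := Nat.find_spec hex
    rw [h0, pow_zero, one_mul] at ha
    exact absurd (hsmall a) (not_le.2 ha)
  obtain ⟨k, hk⟩ := Nat.exists_eq_succ_of_ne_zero hk0
  refine ⟨2 ^ k * w₀, by positivity, fun x => ?_, ?_⟩
  · by_contra! hx
    exact Nat.find_min hex (m := k) (by omega) ⟨x, hx⟩
  · obtain ⟨a, ha⟩ := Nat.find_spec hex
    rw [hk, Nat.succ_eq_add_one, pow_succ] at ha
    exact ⟨a, by rwa [show 2 * (2 ^ k * w₀) = 2 ^ k * 2 * w₀ by ring]⟩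

section Smoothing

/-- The average `x ↦ ∫ v (x + y) dκ(y)`. -/
noncomputable def kernelAvg (κ : Measure ℝ) (v : ℝ → ℝ) (x : ℝ) : ℝ := ∫ y, v (x + y) ∂κ

theorem integrable_of_measurable_of_abs_le {α : Type*} [MeasurableSpace α] {m : Measure α}
    [IsFiniteMeasure m] {f : α → ℝ} (hf : Measurable f) {C : ℝ} (hC : ∀ x, |f x| ≤ C) :
    Integrable f m :=
  Integrable.of_bound hf.aestronglyMeasurable C (.of_forall hC)

theorem abs_integral_le_of_abs_le {α : Type*} [MeasurableSpace α] {m : Measure α}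
    [IsProbabilityMeasure m] {f : α → ℝ} {C : ℝ} (hC : ∀ x, |f x| ≤ C) :
    |∫ x, f x ∂m| ≤ C := by
  simpa using norm_integral_le_of_norm_le_const (μ := m) (f := f) (.of_forall hC)

variable {μ κ : Measure ℝ} [IsProbabilityMeasure μ] [IsProbabilityMeasure κ]

theorem measurable_kernelAvg {v : ℝ → ℝ} (hv : Measurable v) : Measurable (kernelAvg κ v) :=
  (StronglyMeasurable.integral_prod_right' (f := fun p : ℝ × ℝ => v (p.1 + p.2))
    (hv.comp measurable_add).stronglyMeasurable).measurable

theorem abs_kernelAvg_le {v : ℝ → ℝ} {C : ℝ} (hC : ∀ x, |v x| ≤ C) (x : ℝ) :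
    |kernelAvg κ v x| ≤ C :=
  abs_integral_le_of_abs_le fun y => hC (x + y)

theorem integral_kernelAvg {v : ℝ → ℝ} (hv : Measurable v) {C : ℝ} (hC : ∀ x, |v x| ≤ C) :
    ∫ x, kernelAvg κ v x ∂μ = ∫ y, ∫ x, v (x + y) ∂μ ∂κ :=
  integral_integral_swap (f := fun x y => v (x + y))
    (integrable_of_measurable_of_abs_le (hv.comp measurable_add) fun p => hC (p.1 + p.2))

/-- The indicator of `[x, x + w)` as a function of `s - x`. -/
noncomputable def windowInd (w : ℝ) : ℝ → ℝ := (Set.Ico 0 w).indicator fun _ => 1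

theorem measurable_windowInd (w : ℝ) : Measurable (windowInd w) :=
  measurable_const.indicator measurableSet_Ico

theorem windowInd_nonneg (w x : ℝ) : 0 ≤ windowInd w x :=
  Set.indicator_nonneg (fun _ _ => zero_le_one) _

omit [IsProbabilityMeasure μ] in
theorem integral_windowInd_sub (w x : ℝ) :
    ∫ s, windowInd w (s - x) ∂μ = μ.real (Set.Ico x (x + w)) := by
  rw [← integral_indicator_one measurableSet_Ico]
  refine integral_congr_ae (.of_forall fun s => ?_)
  unfold windowInd
  simp only [Set.indicator, Set.mem_Ico, Pi.one_apply]
  exact if_congr ⟨fun h => ⟨by linarith [h.1], by linarith [h.2]⟩,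
    fun h => ⟨by linarith [h.1], by linarith [h.2]⟩⟩ rfl rfl

theorem integral_windowInd_sub_left {w : ℝ} (hw : 0 < w) (s : ℝ) :
    ∫ x, windowInd w (s - x) = w := by
  rw [integral_sub_left_eq_self (windowInd w) volume s]
  unfold windowInd
  rw [integral_indicator measurableSet_Ico]
  simp [hw.le]

theorem integrable_windowInd_sub {w : ℝ} (hw : 0 < w) :
    Integrable (fun p : ℝ × ℝ => windowInd w (p.2 - p.1)) (volume.prod μ) := by
  have hm : Measurable fun p : ℝ × ℝ => windowInd w (p.2 - p.1) :=
    (measurable_windowInd w).comp (measurable_snd.sub measurable_fst)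
  have hI : Integrable (windowInd w) := by
    unfold windowInd
    exact (integrable_indicator_iff measurableSet_Ico).2 (integrableOn_const (by simp))
  refine (integrable_prod_iff' hm.aestronglyMeasurable).2 ⟨.of_forall fun s => ?_, ?_⟩
  · exact hI.comp_sub_left s
  · simp_rw [Real.norm_of_nonneg (windowInd_nonneg _ _), integral_windowInd_sub_left hw]
    exact integrable_const w

theorem measurable_windowMass (μ : Measure ℝ) [IsProbabilityMeasure μ] (w : ℝ) :
    Measurable fun x => μ.real (Set.Ico x (x + w)) := by
  simp_rw [← integral_windowInd_sub]
  exact (StronglyMeasurable.integral_prod_right' (f := fun p : ℝ × ℝ => windowInd w (p.2 - p.1))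
    ((measurable_windowInd w).comp
      (measurable_snd.sub measurable_fst)).stronglyMeasurable).measurable

theorem integrable_windowMass (μ : Measure ℝ) [IsProbabilityMeasure μ] {w : ℝ} (hw : 0 < w) :
    Integrable fun x => μ.real (Set.Ico x (x + w)) := by
  simp_rw [← integral_windowInd_sub]
  exact (integrable_windowInd_sub hw).integral_prod_left

theorem integrable_windowMass_mul (μ : Measure ℝ) [IsProbabilityMeasure μ] {w : ℝ} (hw : 0 < w)
    (y : ℝ) :
    Integrable fun x => μ.real (Set.Ico x (x + w)) * μ.real (Set.Ico (x - y) (x - y + w)) :=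
  (integrable_windowMass μ hw).mul_bdd (c := 1)
    ((measurable_windowMass μ w).comp (measurable_id.sub_const y)).aestronglyMeasurable
    (.of_forall fun x => by
      simp [abs_of_nonneg measureReal_nonneg, measureReal_le_one])

theorem integrable_windowMass_sq (μ : Measure ℝ) [IsProbabilityMeasure μ] {w : ℝ} (hw : 0 < w)
    (y : ℝ) :
    Integrable fun x => μ.real (Set.Ico (x - y) (x - y + w)) ^ 2 := by
  have := (integrable_windowMass_mul μ hw 0).comp_sub_right y
  simpa [sq] using this

theorem integrable_sq_windowMass_sub (μ : Measure ℝ) [IsProbabilityMeasure μ] {w : ℝ}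
    (hw : 0 < w) (y : ℝ) :
    Integrable fun x =>
      (μ.real (Set.Ico x (x + w)) - μ.real (Set.Ico (x - y) (x - y + w))) ^ 2 := by
  have h1 := integrable_windowMass_sq μ hw 0
  simp only [sub_zero] at h1
  refine ((h1.add (integrable_windowMass_sq μ hw y)).sub
    ((integrable_windowMass_mul μ hw y).const_mul 2)).congr (.of_forall fun x => ?_)
  simp only [Pi.add_apply, Pi.sub_apply]
  ring

/-- The averaged energy `∫ ‖G - τ_y G‖²₂ dκ(y)` of the window mass `G(x) = μ [x, x + w)` is small
if averaging with respect to `κ` hardly changes `μ`. -/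
theorem window_energy_le {e Q w : ℝ} (hw : 0 < w) (hQ : 0 < Q)
    (hμ : ∀ x, μ.real (Set.Ico x (x + w)) ≤ Q)
    (hbias : ∀ v : ℝ → ℝ, Measurable v → (∀ x, |v x| ≤ 1) →
      |∫ x, kernelAvg κ v x ∂μ - ∫ x, v x ∂μ| ≤ e) :
    Integrable (fun y => ∫ x, (μ.real (Set.Ico x (x + w))
        - μ.real (Set.Ico (x - y) (x - y + w))) ^ 2) κ ∧
      ∫ y, (∫ x, (μ.real (Set.Ico x (x + w))
        - μ.real (Set.Ico (x - y) (x - y + w))) ^ 2) ∂κ ≤ 2 * (Q * w * e) := by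
  set G : ℝ → ℝ := fun x => μ.real (Set.Ico x (x + w)) with hG
  have hGm : Measurable G := measurable_windowMass μ w
  have hG0 : ∀ x, 0 ≤ G x := fun x => measureReal_nonneg
  have hGI : ∀ x, ∫ s, windowInd w (s - x) ∂μ = G x := integral_windowInd_sub w
  have hFm : Measurable fun p : ℝ × ℝ => G p.1 * windowInd w (p.2 - p.1) :=
    (hGm.comp measurable_fst).mul
      ((measurable_windowInd w).comp (measurable_snd.sub measurable_fst))
  -- Integrating the translate `v (· + y)` against `μ` gives the correlation `∫ G(x) G(x - y) dx`.
  -- So the energy at shift `y` is twice the change of `∫ v dμ` under translation by `y`, and its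
  -- `κ`-average is a bias. Since `|v| ≤ Q w`, dividing by `Q w` makes `v` an admissible test
  -- function.
  let v : ℝ → ℝ := fun s => ∫ x, G x * windowInd w (s - x)
  have hvm : Measurable v :=
    (StronglyMeasurable.integral_prod_left'
      (f := fun p : ℝ × ℝ => G p.1 * windowInd w (p.2 - p.1)) hFm.stronglyMeasurable).measurable
  have hv0 : ∀ s, 0 ≤ v s := fun s =>
    integral_nonneg fun x => mul_nonneg (hG0 x) (windowInd_nonneg _ _)
  have hI : ∀ s, Integrable fun x => windowInd w (s - x) := fun s =>
    by_contra fun h => hw.ne ((integral_undef h).symm.trans (integral_windowInd_sub_left hw s))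
  have hvQ : ∀ s, v s ≤ Q * w := by
    intro s
    rw [← integral_windowInd_sub_left hw s, ← integral_const_mul]
    refine integral_mono_of_nonneg
      (.of_forall fun x => mul_nonneg (hG0 x) (windowInd_nonneg _ _))
      ((hI s).const_mul Q) (.of_forall fun x => ?_)
    exact mul_le_mul_of_nonneg_right (hμ x) (windowInd_nonneg _ _)
  have hvabs : ∀ s, |v s| ≤ Q * w := fun s => by rw [abs_of_nonneg (hv0 s)]; exact hvQ s
  have hshift : ∀ y, ∫ s, v (s + y) ∂μ = ∫ x, G x * G (x - y) := by
    intro y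
    have hswap : ∫ s, v (s + y) ∂μ = ∫ x, ∫ s, G x * windowInd w (s + y - x) ∂μ := by
      refine (integral_integral_swap
        (f := fun x s => G x * windowInd w (s + y - x)) ?_).symm
      have h1 : Integrable (fun p : ℝ × ℝ => windowInd w (p.2 + y - p.1)) (volume.prod μ) := by
        have hm : Measurable fun p : ℝ × ℝ => windowInd w (p.2 + y - p.1) :=
          (measurable_windowInd w).comp ((measurable_snd.add_const y).sub measurable_fst)
        refine (integrable_prod_iff' hm.aestronglyMeasurable).2 ⟨.of_forall fun s => hI (s + y), ?_⟩
        simp_rw [Real.norm_of_nonneg (windowInd_nonneg _ _), integral_windowInd_sub_left hw]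
        exact integrable_const w
      refine h1.bdd_mul (c := Q) (hGm.comp measurable_fst).aestronglyMeasurable
        (.of_forall fun p => ?_)
      simp only [Real.norm_eq_abs, abs_of_nonneg (hG0 _)]
      exact hμ p.1
    rw [hswap]
    refine integral_congr_ae (.of_forall fun x => ?_)
    simp only
    rw [integral_const_mul, ← hGI (x - y)]
    congr 2
    funext s
    congr 1
    ring
  have hE : ∀ y, ∫ x, (G x - G (x - y)) ^ 2 = 2 * (∫ s, v s ∂μ) - 2 * ∫ s, v (s + y) ∂μ := by
    intro y
    have h0 := hshift 0
    simp only [add_zero, sub_zero] at h0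
    have i1 : Integrable fun x => G x ^ 2 := by
      simpa using integrable_windowMass_sq μ hw 0
    have i2 : Integrable fun x => G (x - y) ^ 2 := integrable_windowMass_sq μ hw y
    have i3 : Integrable fun x => 2 * (G x * G (x - y)) :=
      (integrable_windowMass_mul μ hw y).const_mul 2
    have e1 : ∫ x, G (x - y) ^ 2 = ∫ x, G x ^ 2 :=
      integral_sub_right_eq_self (fun x => G x ^ 2) y
    have : ∀ x, (G x - G (x - y)) ^ 2 = G x ^ 2 + G (x - y) ^ 2 - 2 * (G x * G (x - y)) :=
      fun x => by ring
    simp_rw [this]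
    have i12 : Integrable fun x => G x ^ 2 + G (x - y) ^ 2 := i1.add i2
    rw [integral_sub i12 i3, integral_add i1 i2, e1, integral_const_mul, hshift, h0]
    simp_rw [← sq]
    ring
  have hmeas : Measurable fun y => ∫ s, v (s + y) ∂μ :=
    (StronglyMeasurable.integral_prod_left' (f := fun p : ℝ × ℝ => v (p.1 + p.2))
      (hvm.comp measurable_add).stronglyMeasurable).measurable
  have hint : Integrable (fun y => ∫ s, v (s + y) ∂μ) κ :=
    integrable_of_measurable_of_abs_le hmeas fun y =>
      abs_integral_le_of_abs_le fun s => hvabs (s + y)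
  change Integrable (fun y => ∫ x, (G x - G (x - y)) ^ 2) κ ∧
    ∫ y, (∫ x, (G x - G (x - y)) ^ 2) ∂κ ≤ _
  simp_rw [hE]
  refine ⟨(integrable_const _).sub (hint.const_mul 2), ?_⟩
  rw [integral_sub (integrable_const _) (hint.const_mul 2), integral_const, probReal_univ, one_smul,
    integral_const_mul, ← integral_kernelAvg hvm hvabs]
  have hQw : 0 < Q * w := by positivity
  have hb := hbias (fun s => (Q * w)⁻¹ * v s) (hvm.const_mul _) fun s => by
    rw [abs_mul, abs_inv, abs_of_pos hQw, inv_mul_le_one₀ hQw]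
    exact hvabs s
  have hk : ∀ x, kernelAvg κ (fun s => (Q * w)⁻¹ * v s) x = (Q * w)⁻¹ * kernelAvg κ v x :=
    fun x => integral_const_mul _ _
  simp_rw [hk] at hb
  rw [integral_const_mul, integral_const_mul, ← mul_sub, abs_mul, abs_inv, abs_of_pos hQw,
    inv_mul_le_iff₀ hQw] at hb
  have := neg_le_of_abs_le hb
  linarith

end Smoothing

/-! ### Small bias spreads the mass. -/

section Concentration

/-- Otherwise `S` lies in the closed interval of length `w` starting at its infimum, whose mass is
too small. -/
theorem exists_far_points {κ : Measure ℝ} [IsProbabilityMeasure κ] {w : ℝ}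
    (hκ : ∀ x, κ.real (Set.Icc x (x + w)) ≤ 3 / 4) {S : Set ℝ} (hS : 3 / 4 < κ.real S) :
    ∃ y ∈ S, ∃ y' ∈ S, w ≤ y' - y := by
  by_contra! hcon
  have hne : S.Nonempty := by
    rw [Set.nonempty_iff_ne_empty]
    rintro rfl
    norm_num at hS
  have hbdd : BddBelow S := by
    obtain ⟨y', hy'⟩ := hne
    exact ⟨y' - w, fun y hy => by linarith [hcon y hy y' hy']⟩
  have hsub : S ⊆ Set.Icc (sInf S) (sInf S + w) := fun y' hy' =>
    ⟨csInf_le hbdd hy', by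
      have : y' - w ≤ sInf S := le_csInf hne fun y hy => by linarith [hcon y hy y' hy']
      linarith⟩
  exact absurd ((measureReal_mono hsub).trans (hκ _)) (not_le.2 hS)

/-- If the averaged energy of `G` is at most `2 A`, then `G` has a small increment `G - τ_z G` in
`L²` for some `z ≥ w`. -/
theorem exists_far_shift_energy_le {κ : Measure ℝ} [IsProbabilityMeasure κ] {w A : ℝ}
    (hA : 0 < A) (hκ : ∀ x, κ.real (Set.Icc x (x + w)) ≤ 3 / 4) {G : ℝ → ℝ}
    (hsq : ∀ y, Integrable fun x => (G x - G (x - y)) ^ 2)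
    (hint : Integrable (fun y => ∫ x, (G x - G (x - y)) ^ 2) κ)
    (hE : ∫ y, (∫ x, (G x - G (x - y)) ^ 2) ∂κ ≤ 2 * A) :
    ∃ z, w ≤ z ∧ ∫ x, (G x - G (x - z)) ^ 2 ≤ 64 * A := by
  set E : ℝ → ℝ := fun y => ∫ x, (G x - G (x - y)) ^ 2 with hEdef
  have hE0 : ∀ y, 0 ≤ E y := fun y => integral_nonneg fun x => sq_nonneg _
  -- Markov at level `16 A` leaves good shifts of mass at least `7/8 > 3/4`, so two of them, `y` and
  -- `y'`, are `w` apart. Translation invariance and `(a - b)² ≤ 2a² + 2b²` bound the energy at `y'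
  -- - y` by `4 · 16 A`.
  have hmark := mul_meas_ge_le_integral_of_nonneg (.of_forall hE0) hint (16 * A)
  have hbad : κ.real {y | 16 * A ≤ E y} ≤ 1 / 8 := by
    have : 16 * A * κ.real {y | 16 * A ≤ E y} ≤ 2 * A := hmark.trans hE
    nlinarith
  have hgood : 3 / 4 < κ.real {y | E y < 16 * A} := by
    have h1 : (Set.univ : Set ℝ) ⊆ {y | E y < 16 * A} ∪ {y | 16 * A ≤ E y} := fun y _ =>
      lt_or_ge (E y) (16 * A)
    have h2 := (measureReal_mono (μ := κ) h1).trans (measureReal_union_le _ _)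
    rw [probReal_univ] at h2
    linarith
  obtain ⟨y, hy, y', hy', hyy⟩ := exists_far_points hκ hgood
  refine ⟨y' - y, hyy, ?_⟩
  have i1 := (hsq y).comp_add_right y
  have i2 := (hsq y').comp_add_right y
  have e1 : ∫ x, (G (x + y) - G (x + y - y)) ^ 2 = E y :=
    integral_add_right_eq_self (fun x => (G x - G (x - y)) ^ 2) y
  have e2 : ∫ x, (G (x + y) - G (x + y - y')) ^ 2 = E y' :=
    integral_add_right_eq_self (fun x => (G x - G (x - y')) ^ 2) y
  have hle : ∫ x, (G x - G (x - (y' - y))) ^ 2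
      ≤ ∫ x, (2 * (G (x + y) - G (x + y - y)) ^ 2 + 2 * (G (x + y) - G (x + y - y')) ^ 2) := by
    refine integral_mono (hsq _) ((i1.const_mul 2).add (i2.const_mul 2)) fun x => ?_
    simp only
    rw [show x + y - y = x by ring, show x + y - y' = x - (y' - y) by ring]
    nlinarith [sq_nonneg (G (x + y) - G x + (G (x + y) - G (x - (y' - y))))]
  rw [integral_add (i1.const_mul 2) (i2.const_mul 2), integral_const_mul, integral_const_mul,
    e1, e2] at hle
  simp only [Set.mem_ofPred_eq] at hy hy'
  linarith

/-- Some orbit `x, x - z, x - 2z, …` starting in a given interval `[c, c + l)` sees at most the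
average of the integral of `d`. -/
theorem exists_sum_orbit_le {d : ℝ → ℝ} (hd : Integrable d) (hd0 : ∀ x, 0 ≤ d x) {l z : ℝ}
    (hl : 0 < l) (hlz : l ≤ z) (c : ℝ) (N : ℕ) :
    ∃ x ∈ Set.Ico c (c + l), ∑ k ∈ Finset.range N, d (x - k * z) ≤ (∫ x, d x) / l := by
  have hz : 0 < z := hl.trans_le hlz
  have hint : ∀ k : ℕ, Integrable fun x => d (x - k * z) := fun k => hd.comp_sub_right _
  have hsum : Integrable fun x => ∑ k ∈ Finset.range N, d (x - k * z) :=
    integrable_finsetSum _ fun k _ => hint k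
  have hvol : volume.real (Set.Ico c (c + l)) = l := by simp [hl.le]
  obtain ⟨x, hx, hle⟩ := exists_le_setAverage (μ := volume) (s := Set.Ico c (c + l))
    (by simp [hl]) (by simp) hsum.integrableOn
  refine ⟨x, hx, hle.trans ?_⟩
  rw [setAverage_eq, hvol, smul_eq_mul, inv_mul_eq_div]
  gcongr
  rw [integral_finsetSum _ fun k _ => (hint k).integrableOn]
  have hsh : ∀ k : ℕ, ∫ x in Set.Ico c (c + l), d (x - k * z)
      = ∫ x in Set.Ico (c - k * z) (c - k * z + l), d x := by
    intro k
    rw [← integral_indicator measurableSet_Ico, ← integral_indicator measurableSet_Ico,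
      ← integral_sub_right_eq_self (fun x => (Set.Ico (c - k * z) (c - k * z + l)).indicator d x)
        (k * z)]
    refine integral_congr_ae (.of_forall fun x => ?_)
    simp only [Set.indicator, Set.mem_Ico]
    exact if_congr ⟨fun h => ⟨by linarith [h.1], by linarith [h.2]⟩,
      fun h => ⟨by linarith [h.1], by linarith [h.2]⟩⟩ rfl rfl
  simp_rw [hsh]
  rw [← integral_biUnion_finset _ (fun k _ => measurableSet_Ico) ?_
    (fun k _ => hd.integrableOn)]
  · exact setIntegral_le_integral hd (.of_forall hd0)
  · have hlt : ∀ i j : ℕ, i < j → Disjoint (Set.Ico (c - i * z) (c - i * z + l))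
        (Set.Ico (c - j * z) (c - j * z + l)) := by
      intro i j hij
      have hij' : (i : ℝ) + 1 ≤ j := by exact_mod_cast hij
      refine Set.disjoint_left.2 fun x hx hx' => ?_
      nlinarith [hx.1, hx'.2]
    intro i _ j _ hij
    rcases lt_or_gt_of_ne hij with h | h
    · exact hlt i j h
    · exact (hlt j i h).symm

theorem sum_windowMass_orbit_le_one (μ : Measure ℝ) [IsProbabilityMeasure μ] {w z : ℝ}
    (hw : 0 < w) (hz : w ≤ z) (x : ℝ) (N : ℕ) :
    ∑ k ∈ Finset.range N, μ.real (Set.Ico (x - k * z) (x - k * z + w)) ≤ 1 := by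
  rw [← measureReal_biUnion_finset ?_ fun k _ => measurableSet_Ico]
  · exact measureReal_le_one
  · have hlt : ∀ i j : ℕ, i < j → Disjoint (Set.Ico (x - i * z) (x - i * z + w))
        (Set.Ico (x - j * z) (x - j * z + w)) := by
      intro i j hij
      have hij' : (i : ℝ) + 1 ≤ j := by exact_mod_cast hij
      refine Set.disjoint_left.2 fun x hx hx' => ?_
      nlinarith [hx.1, hx'.2]
    intro i _ j _ hij
    rcases lt_or_gt_of_ne hij with h | h
    · exact hlt i j h
    · exact (hlt j i h).symm

/-- A discrete Nash inequality: a nonnegative sequence of total mass at most `1` with small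
Dirichlet energy `B` starts at a small value. -/
theorem sq_le_of_dirichlet_energy_le {g : ℕ → ℝ} {q B : ℝ} (hq : 0 < q) (hB : 0 < B)
    (h0 : q ≤ g 0) (hsum : ∀ N, ∑ k ∈ Finset.range N, g k ≤ 1) {N : ℕ}
    (hNdef : N = ⌊q ^ 2 / (4 * B)⌋₊)
    (hN : ∑ k ∈ Finset.range N, (g k - g (k + 1)) ^ 2 ≤ B) :
    q ^ 3 ≤ 8 * B := by
  -- By Cauchy–Schwarz, within `N` steps the sequence drops by at most `√(N B) ≤ q/2`. So `N + 1`
  -- terms are at least `q/2`, and their total mass gives `(N + 1) q/2 ≤ 1`.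
  have hNle : (N : ℝ) * B ≤ (q / 2) ^ 2 := by
    have := Nat.floor_le (show 0 ≤ q ^ 2 / (4 * B) by positivity)
    rw [← hNdef, le_div_iff₀ (by positivity)] at this
    nlinarith
  have hNgt : q ^ 2 / (4 * B) < N + 1 := hNdef ▸ Nat.lt_floor_add_one _
  have hlow : ∀ m ∈ Finset.range (N + 1), q / 2 ≤ g m := by
    intro m hm
    have hmN : (m : ℝ) ≤ N := by exact_mod_cast Nat.lt_succ_iff.1 (Finset.mem_range.1 hm)
    have htel : ∑ k ∈ Finset.range m, (g k - g (k + 1)) = g 0 - g m := Finset.sum_range_sub' g m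
    have hcs := sq_sum_le_card_mul_sum_sq (s := Finset.range m) (f := fun k => g k - g (k + 1))
    rw [htel, Finset.card_range] at hcs
    have h1 : (g 0 - g m) ^ 2 ≤ (q / 2) ^ 2 := by
      refine hcs.trans (le_trans ?_ hNle)
      refine mul_le_mul hmN (le_trans ?_ hN) (Finset.sum_nonneg fun _ _ => sq_nonneg _) (by positivity)
      exact Finset.sum_le_sum_of_subset_of_nonneg
        (Finset.range_mono (Nat.lt_succ_iff.1 (Finset.mem_range.1 hm)))
        fun _ _ _ => sq_nonneg _
    have h2 := abs_le_of_sq_le_sq' h1 (by positivity)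
    linarith [h2.2]
  have h3 := (Finset.card_nsmul_le_sum _ _ _ hlow).trans (hsum (N + 1))
  rw [Finset.card_range, nsmul_eq_mul] at h3
  push_cast at h3
  have h4 : q ^ 2 / (4 * B) * (q / 2) ≤ 1 := by nlinarith
  rw [div_mul_eq_mul_div, div_le_one (by positivity)] at h4
  nlinarith

/-- One half of the window has mass at least `r/2`, and every window starting in a suitable interval
of length `w/2` contains that half. This leaves room to average over the starting point of an orbit.
-/
theorem exists_half_window {μ : Measure ℝ} [IsProbabilityMeasure μ] {w r x₀ : ℝ} (hw : 0 < w)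
    (h : r ≤ μ.real (Set.Ico x₀ (x₀ + w))) :
    ∃ c, ∀ x ∈ Set.Ico c (c + w / 2), r / 2 ≤ μ.real (Set.Ico x (x + w)) := by
  have hsplit : μ.real (Set.Ico x₀ (x₀ + w)) ≤ μ.real (Set.Ico x₀ (x₀ + w / 2))
      + μ.real (Set.Ico (x₀ + w / 2) (x₀ + w)) := by
    rw [← Set.Ico_union_Ico_eq_Ico (show x₀ ≤ x₀ + w / 2 by linarith)
      (show x₀ + w / 2 ≤ x₀ + w by linarith)]
    exact measureReal_union_le _ _
  rcases le_or_gt (r / 2) (μ.real (Set.Ico x₀ (x₀ + w / 2))) with h1 | h1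
  · exact ⟨x₀ - w / 2, fun x hx => h1.trans (measureReal_mono
      (Set.Ico_subset_Ico (by linarith [hx.2]) (by linarith [hx.1])))⟩
  · have h2 : r / 2 ≤ μ.real (Set.Ico (x₀ + w / 2) (x₀ + w)) := by linarith
    exact ⟨x₀, fun x hx => h2.trans (measureReal_mono
      (Set.Ico_subset_Ico (by linarith [hx.2]) (by linarith [hx.1])))⟩

/-- If averaging over `κ`, whose mass is spread at scale `w`, changes `μ` by at most `e` in total
variation, then `μ` charges no window of length `w` by more than `256 √e`. -/
theorem windowMass_le_of_bias {μ κ : Measure ℝ} [IsProbabilityMeasure μ] [IsProbabilityMeasure κ]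
    {e w : ℝ} (he : 0 < e) (hw : 0 < w) (hκ : ∀ x, κ.real (Set.Icc x (x + w)) ≤ 3 / 4)
    (hbias : ∀ v : ℝ → ℝ, Measurable v → (∀ x, |v x| ≤ 1) →
      |∫ x, kernelAvg κ v x ∂μ - ∫ x, v x ∂μ| ≤ e) (x : ℝ) :
    μ.real (Set.Ico x (x + w)) ≤ 256 * √e := by
  set G : ℝ → ℝ := fun x => μ.real (Set.Ico x (x + w)) with hG
  have hbdd : BddAbove (Set.range G) := ⟨1, by rintro _ ⟨x, rfl⟩; exact measureReal_le_one⟩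
  set Q := ⨆ x, G x with hQdef
  have hGQ : ∀ x, G x ≤ Q := le_ciSup hbdd
  refine (hGQ x).trans ?_
  rcases le_or_gt Q 0 with hQ | hQ
  · exact hQ.trans (by positivity)
  obtain ⟨hint, hE⟩ := window_energy_le hw hQ hGQ hbias
  obtain ⟨z, hwz, hz⟩ := exists_far_shift_energy_le (by positivity : 0 < Q * w * e) hκ
    (integrable_sq_windowMass_sub μ hw) hint hE
  obtain ⟨x₀, hx₀⟩ := exists_lt_of_lt_ciSup (show Q / 2 < ⨆ x, G x by linarith)
  obtain ⟨c, hc⟩ := exists_half_window hw hx₀.le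
  obtain ⟨x₁, hx₁, hsum⟩ := exists_sum_orbit_le (integrable_sq_windowMass_sub μ hw z)
    (fun _ => sq_nonneg _) (half_pos hw) (z := z) (by linarith) c
    ⌊(Q / 4) ^ 2 / (4 * (128 * Q * e))⌋₊
  -- A near-maximal window has mass above `Q/2`, so the orbit starts at `Q/4` or more. Energy `64 Q
  -- w e` averaged over starting points of range `w/2` gives `128 Q e`. The outcome is `Q³ ≤ 256² Q
  -- e`.
  have hnash := sq_le_of_dirichlet_energy_le (g := fun k : ℕ => G (x₁ - k * z))
    (q := Q / 4) (B := 128 * Q * e) (by positivity) (by positivity)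
    (by simpa using (by linarith [hc x₁ hx₁] : Q / 4 ≤ G x₁))
    (sum_windowMass_orbit_le_one μ hw hwz x₁) rfl (by
      have h1 : (∫ x, (G x - G (x - z)) ^ 2) / (w / 2) ≤ 128 * Q * e := by
        rw [div_le_iff₀ (by positivity)]
        exact hz.trans (by linarith)
      refine le_trans (le_of_eq ?_) (hsum.trans h1)
      refine Finset.sum_congr rfl fun k _ => ?_
      simp only [hG]
      push_cast
      rw [show x₁ - (k + 1) * z = x₁ - k * z - z by ring])
  have hsq : Q ^ 2 ≤ (256 * √e) ^ 2 := by
    rw [mul_pow, Real.sq_sqrt he.le]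
    have : Q * Q ^ 2 ≤ Q * (65536 * e) := by nlinarith
    linarith [le_of_mul_le_mul_left this hQ]
  exact (abs_le_of_sq_le_sq' hsq (by positivity)).2

end Concentration

/-! ### Fluctuations over cells and the classical lower bound. -/

section KernelEstimateLowerBound

variable {Ω : Type*} [MeasurableSpace Ω] {P : Measure Ω} [IsProbabilityMeasure P]
  {μ κ : Measure ℝ} [IsProbabilityMeasure μ] [IsProbabilityMeasure κ]

omit [IsProbabilityMeasure P] [IsProbabilityMeasure μ] in
theorem integral_comp_of_map_eq {Y : Ω → ℝ} (hY : Measurable Y) (hlaw : P.map Y = μ) {f : ℝ → ℝ}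
    (hf : Measurable f) : ∫ ω, f (Y ω) ∂P = ∫ x, f x ∂μ := by
  rw [← hlaw, integral_map hY.aemeasurable hf.aestronglyMeasurable]

omit [IsProbabilityMeasure μ] in
/-- Jensen: the mean of the smoothed empirical measure is within the expected error of `μ`. -/
theorem bias_le_of_expected_error {n : ℕ} (hn : 0 < n) {X : Fin n → Ω → ℝ}
    (hX : ∀ l, Measurable (X l)) (hlaw : ∀ l, P.map (X l) = μ) {e : ℝ} (he : 0 < e)
    {L : Ω → ℝ≥0∞} (hL : ∫⁻ ω, L ω ∂P ≤ ENNReal.ofReal e)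
    (H : ∀ᵐ ω ∂P, ∀ v : ℝ → ℝ, Measurable v → (∀ x, |v x| ≤ 1) →
      ENNReal.ofReal |1 / n * ∑ l, kernelAvg κ v (X l ω) - ∫ x, v x ∂μ| ≤ L ω)
    {v : ℝ → ℝ} (hv : Measurable v) (hv1 : ∀ x, |v x| ≤ 1) :
    |∫ x, kernelAvg κ v x ∂μ - ∫ x, v x ∂μ| ≤ e := by
  have hn' : (n : ℝ) ≠ 0 := by exact_mod_cast hn.ne'
  have hm : Measurable (kernelAvg κ v) := measurable_kernelAvg hv
  have hi : ∀ l, Integrable (fun ω => kernelAvg κ v (X l ω)) P := fun l =>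
    integrable_of_measurable_of_abs_le (hm.comp (hX l)) fun ω => abs_kernelAvg_le hv1 _
  have hsum : Integrable (fun ω => 1 / n * ∑ l, kernelAvg κ v (X l ω)) P :=
    (integrable_finsetSum _ fun l _ => hi l).const_mul _
  have hmean : ∫ ω, (1 / n * ∑ l, kernelAvg κ v (X l ω) - ∫ x, v x ∂μ) ∂P
      = ∫ x, kernelAvg κ v x ∂μ - ∫ x, v x ∂μ := by
    rw [integral_sub hsum (integrable_const _), integral_const_mul,
      integral_finsetSum _ fun l _ => hi l]
    simp_rw [integral_comp_of_map_eq (hX _) (hlaw _) hm]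
    simp [hn']
  rw [← hmean]
  refine (abs_integral_le_integral_abs).trans ?_
  have habs : Integrable (fun ω => |1 / n * ∑ l, kernelAvg κ v (X l ω) - ∫ x, v x ∂μ|) P :=
    (hsum.sub (integrable_const _)).abs
  rw [← ENNReal.ofReal_le_ofReal_iff he.le, ofReal_integral_eq_lintegral_ofReal habs
      (.of_forall fun ω => abs_nonneg _)]
  refine (lintegral_mono_ae ?_).trans hL
  filter_upwards [H] with ω hω using hω v hv hv1

/-- Fluctuations of the number of observations in one cell. -/
theorem expected_cell_fluctuation_ge {n : ℕ} {X : Fin n → Ω → ℝ}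
    (hX : ∀ l, Measurable (X l)) (hind : iIndepFun X P) (hlaw : ∀ l, P.map (X l) = μ)
    {u : ℝ → ℝ} (hu : Measurable u) (hu0 : ∀ x, 0 ≤ u x) (hu1 : ∀ x, u x ≤ 1) {q : ℝ}
    (hq : ∫ x, u x ∂μ = q) (hq4 : q ≤ 1 / 4) {τ : ℝ} (hτ : 0 < τ)
    (hτq : 1 + 3 * (n * q) ≤ τ ^ 2) {I : Set ℝ} (hI : MeasurableSet I)
    (huI : ∀ x ∈ I, 3 / 4 ≤ u x) :
    n * μ.real I / (5 * τ) ≤ ∫ ω, |∑ l, (u (X l ω) - q)| ∂P := by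
  have hq0 : 0 ≤ q := hq ▸ integral_nonneg hu0
  have hb : ∀ x, |u x - q| ≤ 1 := fun x => abs_le.2 ⟨by linarith [hu0 x], by linarith [hu1 x]⟩
  have hum : Measurable fun x => u x - q := hu.sub_const q
  have hui : Integrable u μ := integrable_of_measurable_of_abs_le hu (C := 1) fun x => by
    rw [abs_of_nonneg (hu0 x)]; exact hu1 x
  have hu2i : Integrable (fun x => (u x - q) ^ 2) μ :=
    integrable_of_measurable_of_abs_le (hum.pow_const 2) (C := 1) fun x => by
      rw [abs_pow]; exact pow_le_one₀ (abs_nonneg _) (hb x)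
  set σ := ∫ x, (u x - q) ^ 2 ∂μ with hσ
  have hσ0 : 0 ≤ σ := integral_nonneg fun x => sq_nonneg _
  have hσq : σ ≤ q := by
    have h1 : σ ≤ ∫ x, (u x - 2 * q * u x + q ^ 2) ∂μ := by
      refine integral_mono hu2i ((hui.sub (hui.const_mul _)).add (integrable_const _)) fun x => ?_
      simp only
      nlinarith [hu0 x, hu1 x]
    rw [integral_add (f := fun x => u x - 2 * q * u x) (hui.sub (hui.const_mul _))
      (integrable_const _), integral_sub hui (hui.const_mul _), integral_const_mul, hq] at h1
    simp only [integral_const, probReal_univ, smul_eq_mul, one_mul] at h1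
    nlinarith
  -- On `I` the deviation `u - q` is at least `3/4 - 1/4 = 1/2`.
  have hσI : μ.real I / 4 ≤ σ := by
    have h1 : ∫ x, I.indicator (fun _ => (1 / 4 : ℝ)) x ∂μ ≤ σ := by
      refine integral_mono ((integrable_const _).indicator hI) hu2i fun x => ?_
      by_cases hx : x ∈ I
      · simp only [Set.indicator_of_mem hx]
        nlinarith [huI x hx]
      · simp only [Set.indicator_of_notMem hx]
        positivity
    rw [integral_indicator_const _ hI, smul_eq_mul] at h1
    linarith
  obtain ⟨m2, m4⟩ := iIndepFun_moments_sum (P := P) (Y := fun l ω => u (X l ω) - q)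
    (fun l => hum.comp (hX l)) (fun l ω => hb _) (hind.comp (fun _ x => u x - q) fun _ => hum)
    (fun l => by
      rw [integral_comp_of_map_eq (hX l) (hlaw l) hum, integral_sub hui (integrable_const _), hq]
      simp)
    (fun l => integral_comp_of_map_eq (hX l) (hlaw l) (hum.pow_const 2)) Finset.univ
  rw [Finset.card_univ, Fintype.card_fin] at m2 m4
  have hZ : ∀ ω, |∑ l, (u (X l ω) - q)| ≤ n := fun ω => by
    refine (Finset.abs_sum_le_sum_abs _ _).trans
      ((Finset.sum_le_sum fun l _ => hb (X l ω)).trans ?_)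
    simp
  have hnσ : 0 ≤ n * σ := by positivity
  have hfin := integral_abs_ge_of_moments
    (Finset.measurable_fun_sum Finset.univ fun l _ => hum.comp (hX l)) hZ hτ m2 (m4.trans (by
      have : 1 + 3 * (n * σ) ≤ τ ^ 2 := le_trans (by gcongr) hτq
      nlinarith))
  refine le_trans ?_ hfin
  have hn0 : (0 : ℝ) ≤ n := by positivity
  rw [div_le_div_iff₀ (by positivity) hτ]
  have h1 : n * (μ.real I / 4) ≤ n * σ := by gcongr
  nlinarith [mul_le_mul_of_nonneg_right h1 hτ.le, mul_nonneg hnσ hτ.le]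

/-- Cells `[pj + a, pj + a + 2p)`, `j ∈ ℤ`, overlap at most twice. -/
theorem sum_indicator_cell_le_two {p : ℝ} (hp : 0 < p) (a s : ℝ) (F : Finset ℤ) :
    ∑ j ∈ F, (Set.Ico (j • p + a) (j • p + a + 2 * p)).indicator (fun _ => (1 : ℝ)) s ≤ 2 := by
  classical
  simp only [Set.indicator_apply]
  rw [Finset.sum_boole]
  have hsub : F.filter (fun j : ℤ => s ∈ Set.Ico (j • p + a) (j • p + a + 2 * p))
      ⊆ {⌊(s - a) / p⌋, ⌊(s - a) / p⌋ - 1} := by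
    intro j hj
    obtain ⟨-, h1, h2⟩ := Finset.mem_filter.1 hj
    rw [zsmul_eq_mul] at h1 h2
    have h3 : j ≤ ⌊(s - a) / p⌋ := Int.le_floor.2 ((le_div_iff₀ hp).2 (by linarith))
    have h4 : ⌊(s - a) / p⌋ < j + 2 := Int.floor_lt.2 ((div_lt_iff₀ hp).2 (by
      push_cast; linarith))
    simp only [Finset.mem_insert, Finset.mem_singleton]
    omega
  exact_mod_cast (Finset.card_le_card hsub).trans Finset.card_le_two

theorem exists_finset_cells_half_le (μ : Measure ℝ) [IsProbabilityMeasure μ] {p : ℝ} (hp : 0 < p) :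
    ∃ F : Finset ℤ, 1 / 2 ≤ ∑ j ∈ F, μ.real (Set.Ico (j • p) ((j + 1) • p)) := by
  have hsum : HasSum (fun j : ℤ => μ.real (Set.Ico (j • p) ((j + 1) • p))) 1 := by
    have h1 := measure_iUnion (μ := μ) (Set.pairwise_disjoint_Ico_zsmul p)
      fun _ => measurableSet_Ico
    rw [iUnion_Ico_zsmul hp, measure_univ] at h1
    have h2 := (ENNReal.summable_toReal (h1 ▸ ENNReal.one_ne_top)).hasSum
    rw [← ENNReal.tsum_toReal_eq fun _ => measure_ne_top _ _, ← h1, ENNReal.toReal_one] at h2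
    exact h2
  obtain ⟨F, hF⟩ := (hsum.eventually_const_lt (show (1 / 2 : ℝ) < 1 by norm_num)).exists
  exact ⟨F, hF.le⟩

theorem windowMass_four_mul_le {w Q : ℝ}
    (hQ : ∀ x, μ.real (Set.Ico x (x + w)) ≤ Q) (x : ℝ) :
    μ.real (Set.Ico x (x + 4 * w)) ≤ 4 * Q := by
  have hsub : Set.Ico x (x + 4 * w) ⊆ (Set.Ico x (x + w) ∪ Set.Ico (x + w) (x + w + w)) ∪
      (Set.Ico (x + w + w) (x + w + w + w) ∪ Set.Ico (x + w + w + w) (x + w + w + w + w)) := by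
    intro y hy
    simp only [Set.mem_union, Set.mem_Ico] at hy ⊢
    grind
  have h1 := measureReal_mono (μ := μ) hsub
  have h2 := measureReal_union_le (μ := μ)
    (Set.Ico x (x + w) ∪ Set.Ico (x + w) (x + w + w))
    (Set.Ico (x + w + w) (x + w + w + w) ∪ Set.Ico (x + w + w + w) (x + w + w + w + w))
  have h3 := measureReal_union_le (μ := μ) (Set.Ico x (x + w)) (Set.Ico (x + w) (x + w + w))
  have h4 := measureReal_union_le (μ := μ) (Set.Ico (x + w + w) (x + w + w + w))
    (Set.Ico (x + w + w + w) (x + w + w + w + w))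
  linarith [hQ x, hQ (x + w), hQ (x + w + w), hQ (x + w + w + w)]

omit [IsProbabilityMeasure κ] in
theorem kernelAvg_indicator_Ico (c l x : ℝ) :
    kernelAvg κ ((Set.Ico c (c + l)).indicator fun _ => 1) x
      = κ.real (Set.Ico (c - x) (c - x + l)) := by
  unfold kernelAvg
  rw [← integral_indicator_one measurableSet_Ico]
  refine integral_congr_ae (.of_forall fun y => ?_)
  simp only [Set.indicator, Set.mem_Ico, Pi.one_apply]
  exact if_congr ⟨fun h => ⟨by linarith [h.1], by linarith [h.2]⟩,
    fun h => ⟨by linarith [h.1], by linarith [h.2]⟩⟩ rfl rfl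

/-- By Fubini, the smoothed mass of an interval is a `κ`-average of `μ`-masses of its translates. -/
theorem integral_kernelAvg_indicator_Ico_le {c l B : ℝ}
    (hB : ∀ x, μ.real (Set.Ico x (x + l)) ≤ B) :
    ∫ x, kernelAvg κ ((Set.Ico c (c + l)).indicator fun _ => 1) x ∂μ ≤ B := by
  have hv : Measurable ((Set.Ico c (c + l)).indicator fun _ : ℝ => (1 : ℝ)) :=
    measurable_const.indicator measurableSet_Ico
  have hv1 : ∀ x, |(Set.Ico c (c + l)).indicator (fun _ : ℝ => (1 : ℝ)) x| ≤ 1 := fun x => by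
    by_cases h : x ∈ Set.Ico c (c + l) <;> simp [h]
  rw [integral_kernelAvg hv hv1]
  have e : ∀ y, ∫ x, (Set.Ico c (c + l)).indicator (fun _ : ℝ => (1 : ℝ)) (x + y) ∂μ
      = μ.real (Set.Ico (c - y) (c - y + l)) := fun y => by
    rw [← kernelAvg_indicator_Ico]
    unfold kernelAvg
    simp_rw [add_comm]
  simp_rw [e]
  refine (le_abs_self _).trans (abs_integral_le_of_abs_le fun y => ?_)
  rw [abs_of_nonneg measureReal_nonneg]
  exact hB _

/-- The summed cell fluctuations of the smoothed empirical measure are controlled by its error. -/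
theorem sum_cell_fluctuation_le {n : ℕ} (hn : 0 < n) {x : Fin n → ℝ} {e : ℝ} (he : 0 < e)
    {L : ℝ≥0∞}
    (H : ∀ v : ℝ → ℝ, Measurable v → (∀ x, |v x| ≤ 1) →
      ENNReal.ofReal |1 / n * ∑ l, kernelAvg κ v (x l) - ∫ x, v x ∂μ| ≤ L)
    (hbias : ∀ v : ℝ → ℝ, Measurable v → (∀ x, |v x| ≤ 1) →
      |∫ x, kernelAvg κ v x ∂μ - ∫ x, v x ∂μ| ≤ e)
    {F : Finset ℤ} {J : ℤ → Set ℝ} (hJ : ∀ j, MeasurableSet (J j))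
    (hF : ∀ s, ∑ j ∈ F, (J j).indicator (fun _ => (1 : ℝ)) s ≤ 2) :
    ENNReal.ofReal (∑ j ∈ F, |∑ l, (kernelAvg κ ((J j).indicator fun _ => 1) (x l)
        - ∫ s, kernelAvg κ ((J j).indicator fun _ => 1) s ∂μ)|)
      ≤ ENNReal.ofReal (2 * n) * (L + ENNReal.ofReal e) := by
  have hn' : (0 : ℝ) < n := by exact_mod_cast hn
  let b : ℤ → ℝ → ℝ := fun j => (J j).indicator fun _ => 1
  have hbm : ∀ j, Measurable (b j) := fun j => measurable_const.indicator (hJ j)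
  have hb0 : ∀ j s, 0 ≤ b j s := fun j s => Set.indicator_nonneg (fun _ _ => zero_le_one) s
  have hb1 : ∀ j s, |b j s| ≤ 1 := fun j s => by
    by_cases h : s ∈ J j <;> simp [b, h]
  let Z : ℤ → ℝ := fun j => ∑ l, (kernelAvg κ (b j) (x l) - ∫ s, kernelAvg κ (b j) s ∂μ)
  let ς : ℤ → ℝ := fun j => if 0 ≤ Z j then 1 else -1
  have hς1 : ∀ j, |ς j| = 1 := fun j => by
    by_cases h : 0 ≤ Z j <;> simp [ς, h]
  have hςZ : ∀ j, ς j * Z j = |Z j| := fun j => by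
    by_cases h : 0 ≤ Z j
    · simp [ς, h, abs_of_nonneg h]
    · simp [ς, h, abs_of_neg (not_le.1 h)]
  -- One test function collects all cells with the signs of their fluctuations; the factor `1/2`
  -- compensates the twofold overlap.
  let v : ℝ → ℝ := fun s => ∑ j ∈ F, ς j / 2 * b j s
  have hvm : Measurable v := Finset.measurable_fun_sum F fun j _ => (hbm j).const_mul _
  have hv1 : ∀ s, |v s| ≤ 1 := fun s => by
    refine (Finset.abs_sum_le_sum_abs _ _).trans ?_
    have : ∑ j ∈ F, |ς j / 2 * b j s| = (∑ j ∈ F, b j s) / 2 := by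
      rw [Finset.sum_div]
      refine Finset.sum_congr rfl fun j _ => ?_
      rw [abs_mul, abs_div, hς1, abs_of_nonneg (hb0 j s), abs_two]
      ring
    rw [this]
    linarith [hF s]
  have hkv : ∀ s, kernelAvg κ v s = ∑ j ∈ F, ς j / 2 * kernelAvg κ (b j) s := fun s => by
    unfold kernelAvg
    rw [integral_finsetSum]
    · exact Finset.sum_congr rfl fun j _ => integral_const_mul _ _
    · exact fun j _ => (integrable_of_measurable_of_abs_le
        ((hbm j).comp (measurable_const_add s)) fun y => hb1 j _).const_mul _
  have hkvi : ∫ s, kernelAvg κ v s ∂μ = ∑ j ∈ F, ς j / 2 * ∫ s, kernelAvg κ (b j) s ∂μ := by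
    simp_rw [hkv]
    rw [integral_finsetSum]
    · exact Finset.sum_congr rfl fun j _ => integral_const_mul _ _
    · exact fun j _ => (integrable_of_measurable_of_abs_le
        (measurable_kernelAvg (hbm j)) fun y => abs_kernelAvg_le (hb1 j) _).const_mul _
  have hid : ∑ j ∈ F, |Z j|
      = 2 * n * (1 / n * ∑ l, kernelAvg κ v (x l) - ∫ s, kernelAvg κ v s ∂μ) := by
    rw [hkvi]
    simp_rw [hkv, ← hςZ]
    rw [Finset.sum_comm, Finset.mul_sum, ← Finset.sum_sub_distrib, Finset.mul_sum]
    refine Finset.sum_congr rfl fun j _ => ?_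
    rw [← Finset.mul_sum]
    simp only [Z, Finset.sum_sub_distrib, Finset.sum_const, Finset.card_univ, Fintype.card_fin,
      nsmul_eq_mul]
    field_simp
  change ENNReal.ofReal (∑ j ∈ F, |Z j|) ≤ _
  rw [hid, ENNReal.ofReal_mul (by positivity)]
  gcongr
  refine le_trans ?_ (add_le_add (H v hvm hv1) le_rfl)
  rw [← ENNReal.ofReal_add (abs_nonneg _) he.le]
  refine ENNReal.ofReal_le_ofReal ?_
  have h1 := le_abs_self (1 / n * ∑ l, kernelAvg κ v (x l) - ∫ s, v s ∂μ)
  have h2 := neg_le_of_abs_le (hbias v hvm hv1)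
  linarith

/-- Distribution-free lower bound for kernel density estimates with a nonnegative kernel: if the
expected total-variation-type error `L` has mean at most `e`, then `n ≥ c e^{-5/2}`. -/
theorem card_sample_ge_of_expected_error (hκ : κ ≪ volume) {n : ℕ} (hn : 0 < n)
    {X : Fin n → Ω → ℝ} (hX : ∀ l, Measurable (X l)) (hind : iIndepFun X P)
    (hlaw : ∀ l, P.map (X l) = μ) {e : ℝ} (he : 0 < e)
    {L : Ω → ℝ≥0∞} (hL : ∫⁻ ω, L ω ∂P ≤ ENNReal.ofReal e)
    (H : ∀ᵐ ω ∂P, ∀ v : ℝ → ℝ, Measurable v → (∀ x, |v x| ≤ 1) →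
      ENNReal.ofReal |1 / n * ∑ l, kernelAvg κ v (X l ω) - ∫ x, v x ∂μ| ≤ L ω) :
    (1 / 4096 : ℝ) ^ 5 ≤ n * √e ^ 5 := by
  have hn1 : (1 : ℝ) ≤ n := by exact_mod_cast hn
  have hs0 : 0 < √e := Real.sqrt_pos.2 he
  have hse : √e ^ 2 = e := Real.sq_sqrt he.le
  -- For large `e` the claim follows from `n ≥ 1`. Below the threshold the cell mean is at most
  -- `1024 √e ≤ 1/4`, as the fluctuation bound requires.
  rcases le_or_gt (1 / 4096) (√e) with hbig | hsmall
  · calc (1 / 4096 : ℝ) ^ 5 ≤ 1 * √e ^ 5 := by rw [one_mul]; gcongr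
      _ ≤ n * √e ^ 5 := by gcongr
  have hbias := fun v hv hv1 =>
    bias_le_of_expected_error (κ := κ) (v := v) hn hX hlaw he hL H hv hv1
  obtain ⟨w, hw, hκ1, a, ha⟩ := exists_length_scale κ hκ
  have hQ := windowMass_le_of_bias he hw hκ1 hbias
  have hQ4 := windowMass_four_mul_le hQ
  set τ := √(1 + 3 * (n * (4 * (256 * √e)))) with hτdef
  have hτ2 : τ ^ 2 = 1 + 3 * (n * (4 * (256 * √e))) := Real.sq_sqrt (by positivity)
  have hτ : 0 < τ := Real.sqrt_pos.2 (by positivity)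
  have hp : 0 < 2 * w := by positivity
  obtain ⟨F, hF⟩ := exists_finset_cells_half_le μ hp
  -- `J j` contains the sum of the cell `[2wj, 2w(j+1))` and the heavy interval `[a, a + 2w]` of
  -- `κ`. An observation in the cell therefore gives `J j` smoothed mass above `3/4`.
  let J : ℤ → Set ℝ := fun j => Set.Ico (j • (2 * w) + a) (j • (2 * w) + a + 2 * (2 * w))
  have hJ4 : ∀ j : ℤ, J j = Set.Ico (j • (2 * w) + a) (j • (2 * w) + a + 4 * w) := fun j => by
    simp only [J]; congr 1; ring
  let u : ℤ → ℝ → ℝ := fun j => kernelAvg κ ((J j).indicator fun _ => 1)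
  have hum : ∀ j, Measurable (u j) := fun j =>
    measurable_kernelAvg (measurable_const.indicator measurableSet_Ico)
  have hu : ∀ j s, u j s
      = κ.real (Set.Ico (j • (2 * w) + a - s) (j • (2 * w) + a - s + 4 * w)) := fun j s => by
    simp only [u, hJ4, kernelAvg_indicator_Ico]
  let Z : ℤ → Ω → ℝ := fun j ω => ∑ l, (u j (X l ω) - ∫ s, u j s ∂μ)
  have hlow : ∀ j ∈ F, n * μ.real (Set.Ico (j • (2 * w)) ((j + 1) • (2 * w))) / (5 * τ)
      ≤ ∫ ω, |Z j ω| ∂P := by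
    intro j _
    have hq : ∫ s, u j s ∂μ ≤ 4 * (256 * √e) := by
      simp only [u, hJ4]
      exact integral_kernelAvg_indicator_Ico_le hQ4
    refine expected_cell_fluctuation_ge hX hind hlaw (hum j)
      (fun x => by rw [hu]; exact measureReal_nonneg)
      (fun x => by rw [hu]; exact measureReal_le_one) rfl (hq.trans (by linarith)) hτ
      (by rw [hτ2]; gcongr) measurableSet_Ico fun x hx => ?_
    rw [hu]
    refine ha.le.trans (measureReal_mono fun y hy => ?_)
    simp only [zsmul_eq_mul, Int.cast_add, Int.cast_one, Set.mem_Ico, Set.mem_Icc] at hx hy ⊢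
    constructor <;> nlinarith [hx.1, hx.2, hy.1, hy.2]
  have hZi : ∀ j, Integrable (fun ω => |Z j ω|) P := fun j =>
    (integrable_finsetSum _ fun l _ => (integrable_of_measurable_of_abs_le
      ((hum j).comp (hX l)) (C := 1) fun ω => by
        simp only [Function.comp_apply]
        rw [hu, abs_of_nonneg measureReal_nonneg]; exact measureReal_le_one).sub
        (integrable_const _)).abs
  -- The error `L` need not be measurable, so it is handled by monotonicity of the lower integral
  -- and by adding only a constant to it.
  have hup : ∫ ω, ∑ j ∈ F, |Z j ω| ∂P ≤ 2 * n * (e + e) := by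
    rw [← ENNReal.ofReal_le_ofReal_iff (by positivity),
      ofReal_integral_eq_lintegral_ofReal (integrable_finsetSum _ fun j _ => hZi j)
        (.of_forall fun ω => Finset.sum_nonneg fun _ _ => abs_nonneg _)]
    calc ∫⁻ ω, ENNReal.ofReal (∑ j ∈ F, |Z j ω|) ∂P
        ≤ ∫⁻ ω, ENNReal.ofReal (2 * n) * (L ω + ENNReal.ofReal e) ∂P := by
          refine lintegral_mono_ae ?_
          filter_upwards [H] with ω hω
          exact sum_cell_fluctuation_le hn he hω hbias (fun j => measurableSet_Ico)
            fun s => sum_indicator_cell_le_two hp a s F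
      _ = ENNReal.ofReal (2 * n) * (∫⁻ ω, L ω ∂P + ENNReal.ofReal e) := by
          rw [lintegral_const_mul' _ _ ENNReal.ofReal_ne_top,
            lintegral_add_right _ measurable_const, lintegral_const, measure_univ, mul_one]
      _ ≤ ENNReal.ofReal (2 * n) * (ENNReal.ofReal e + ENNReal.ofReal e) := by gcongr
      _ = ENNReal.ofReal (2 * n * (e + e)) := by
          rw [ENNReal.ofReal_mul (p := 2 * (n : ℝ)) (by positivity), ENNReal.ofReal_add he.le he.le]
  have hmain : n * (1 / 2) / (5 * τ) ≤ 2 * n * (e + e) := by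
    refine le_trans ?_ hup
    rw [integral_finsetSum _ fun j _ => hZi j]
    refine le_trans ?_ (Finset.sum_le_sum hlow)
    rw [← Finset.sum_div, ← Finset.mul_sum]
    gcongr
  have hτe : 1 ≤ 40 * e * τ := by
    rw [div_le_iff₀ (by positivity)] at hmain
    have : n * 1 ≤ n * (40 * e * τ) := by linarith
    exact le_of_mul_le_mul_left this (by positivity)
  have hsq : 1 ≤ (40 * e) ^ 2 * τ ^ 2 := by
    rw [← mul_pow]; exact one_le_pow₀ hτe
  have hsq' : 1 ≤ (40 * √e ^ 2) ^ 2 * (1 + 3 * (n * (4 * (256 * √e)))) := by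
    rwa [hse, ← hτ2]
  generalize √e = s at hsq' hsmall hs0 ⊢
  have h4 : s ^ 4 ≤ (1 / 4096) ^ 4 := by gcongr
  -- As `s < 1/4096`, the term `1600 s⁴` is negligible against `1`, and `n s⁵` has to supply the
  -- rest.
  have e1 : (40 * s ^ 2) ^ 2 * (1 + 3 * (n * (4 * (256 * s))))
      = 1600 * s ^ 4 + 4915200 * (n * s ^ 5) := by ring
  rw [e1] at hsq'
  norm_num at h4 ⊢
  linarith

end KernelEstimateLowerBound

/-! ### Kernel estimates as smoothed empirical measures, and the conclusion. -/

/-- The law with density `y ↦ K (y / h) / h`. -/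
noncomputable def kernelLaw (K : ℝ → ℝ) (h : ℝ) : Measure ℝ :=
  volume.withDensity fun y => ENNReal.ofReal (K (y / h) / h)

section KernelLaw

variable {K : ℝ → ℝ} {h : ℝ}

theorem integral_withDensity_ofReal {f v : ℝ → ℝ} (hf : AEMeasurable f)
    (hf0 : ∀ᵐ x, 0 ≤ f x) :
    ∫ x, v x ∂(volume.withDensity fun x => ENNReal.ofReal (f x)) = ∫ x, f x * v x := by
  rw [integral_withDensity_eq_integral_toReal_smul₀ hf.ennreal_ofReal
    (.of_forall fun _ => ENNReal.ofReal_lt_top)]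
  refine integral_congr_ae ?_
  filter_upwards [hf0] with x hx
  rw [ENNReal.toReal_ofReal hx, smul_eq_mul]

theorem IsDensityKernel.integrable_scaled (hK : IsDensityKernel K) (hh : 0 < h) :
    Integrable fun y => K (y / h) / h :=
  (hK.integrable.comp_div hh.ne').div_const h

theorem IsDensityKernel.isProbabilityMeasure_kernelLaw (hK : IsDensityKernel K) (hh : 0 < h) :
    IsProbabilityMeasure (kernelLaw K h) := by
  refine ⟨?_⟩
  rw [kernelLaw, withDensity_apply _ MeasurableSet.univ, setLIntegral_univ,
    ← ofReal_integral_eq_lintegral_ofReal (hK.integrable_scaled hh)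
      (.of_forall fun y => div_nonneg (hK.nonneg _) hh.le), integral_div,
    Measure.integral_comp_div K h, hK.integral_eq_one, abs_of_pos hh, smul_eq_mul, mul_one,
    div_self hh.ne', ENNReal.ofReal_one]

theorem IsDensityKernel.kernelAvg_kernelLaw (hK : IsDensityKernel K) (hh : 0 < h) (v : ℝ → ℝ)
    (x : ℝ) : kernelAvg (kernelLaw K h) v x = ∫ s, K ((s - x) / h) / h * v s := by
  unfold kernelAvg kernelLaw
  have hm : Measurable fun y => K (y / h) / h :=
    (hK.measurable.comp (measurable_id.div_const h)).div_const h
  rw [integral_withDensity_ofReal hm.aemeasurable (.of_forall fun y => div_nonneg (hK.nonneg _) hh.le),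
    ← integral_sub_right_eq_self (fun y => K (y / h) / h * v (x + y)) x]
  simp only [add_sub_cancel]

theorem IsDensityKernel.mean_kernelAvg_eq_integral_kde (hK : IsDensityKernel K) (hh : 0 < h)
    {n : ℕ} (X : Fin n → ℝ) {v : ℝ → ℝ} (hv : Measurable v) (hv1 : ∀ x, |v x| ≤ 1) :
    1 / n * ∑ l, kernelAvg (kernelLaw K h) v (X l) = ∫ x, kde K h X x * v x := by
  simp_rw [hK.kernelAvg_kernelLaw hh]
  rw [← integral_finsetSum, ← integral_const_mul]
  · refine integral_congr_ae (.of_forall fun x => ?_)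
    simp only [kde]
    rw [← Finset.sum_mul, ← Finset.sum_div]
    by_cases hn : (n : ℝ) = 0
    · simp [hn]
    · field_simp
  · exact fun l _ => ((hK.integrable_scaled hh).comp_sub_right (X l)).mul_bdd (c := 1)
      hv.aestronglyMeasurable (.of_forall hv1)

end KernelLaw

/-- Makes the difference of two tomograms the signed tomogram of `σ - ρ`, in the form needed for the
`L¹` contraction. -/
theorem IsTomogram.sub_fourier {ρ σ : ModeSpace →L[ℂ] ModeSpace} (hσ : IsSelfAdjoint σ)
    (hρ : IsSelfAdjoint ρ) (hfin : traceNorm ρ ≠ ∞) {μ ν : ℝ} {W V : ℝ → ℝ}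
    (hV : IsTomogram σ μ ν V) (hW : IsTomogram ρ μ ν W) (hfin' : traceNorm (σ - ρ) ≠ ∞) (t : ℝ) :
    ∫ x : ℝ, ((V x - W x : ℝ) : ℂ) * Complex.exp (((t * x : ℝ) : ℂ) * Complex.I)
      = opTrace ((σ - ρ) ∘L quadExp μ ν t) := by
  have hb : ∀ x : ℝ, ‖Complex.exp (((t * x : ℝ) : ℂ) * Complex.I)‖ ≤ 1 := fun x =>
    (Complex.norm_exp_ofReal_mul_I _).le
  have hc : Continuous fun x : ℝ => Complex.exp (((t * x : ℝ) : ℂ) * Complex.I) := by fun_prop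
  rw [← opTrace_sub_comp hσ hρ (norm_quadExp_le μ ν t) hfin hfin', ← hV.fourier, ← hW.fourier,
    ← integral_sub (Integrable.ofReal_mul_of_continuous hV.integrable hc hb)
      (Integrable.ofReal_mul_of_continuous hW.integrable hc hb)]
  simp only [Complex.ofReal_sub, sub_mul]

theorem theorem3 :
    ∃ c : ℝ, 0 < c ∧
      ∀ (ρ : ModeSpace →L[ℂ] ModeSpace), IsDensityOperator ρ →
      ∀ (μ ν : ℝ), (μ, ν) ≠ (0, 0) →
      ∀ (W : ℝ → ℝ), IsTomogram ρ μ ν W →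
      ∀ (K : ℝ → ℝ), IsDensityKernel K →
      ∀ (n : ℕ) (h : ℝ), 0 < n → 0 < h →
      ∀ (Ω : Type*) [MeasurableSpace Ω] (P : Measure Ω) [IsProbabilityMeasure P]
        (X : Fin n → Ω → ℝ),
        (∀ l, Measurable (X l)) → iIndepFun X P →
        (∀ l, P.map (X l) = volume.withDensity (fun x => ENNReal.ofReal (W x))) →
      ∀ (ρhat : Ω → (ModeSpace →L[ℂ] ModeSpace)),
        (∀ᵐ ω ∂P, IsSelfAdjoint (ρhat ω) ∧
          IsTomogram (ρhat ω) μ ν (kde K h (fun l => X l ω))) →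
      ∀ ε : ℝ, 0 < ε →
        ∫⁻ ω, traceDist (ρhat ω) ρ ∂P ≤ ENNReal.ofReal ε →
        c * ε ^ (-(5 / 2) : ℝ) ≤ n := by
  refine ⟨(1 / 4096) ^ 5 / 8, by positivity, ?_⟩
  intro ρ hρ μ ν _ W hW K hK n h hn hh Ω _ P _ X hX hind hlaw ρhat hρhat ε hε herr
  -- The total mass of `W` is read off from the law of an observation, which exists since `n > 0`.
  have hprob : IsProbabilityMeasure (volume.withDensity fun x => ENNReal.ofReal (W x)) := by
    rw [← hlaw ⟨0, hn⟩]
    exact Measure.isProbabilityMeasure_map (hX _).aemeasurable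
  have hprob' := hK.isProbabilityMeasure_kernelLaw hh
  -- The classical bound is applied with `e = 2ε`, since the full trace norm dominates the `L¹`
  -- error. The factor `8` in the constant covers `√2 ^ 5`.
  have hL : ∫⁻ ω, 2 * traceDist (ρhat ω) ρ ∂P ≤ ENNReal.ofReal (2 * ε) := by
    rw [lintegral_const_mul' _ _ (by simp), ENNReal.ofReal_mul (by norm_num)]
    simpa using mul_le_mul_right herr 2
  have hcore := card_sample_ge_of_expected_error (κ := kernelLaw K h)
    (withDensity_absolutelyContinuous _ _) hn hX hind hlaw (by positivity) hL (by
      filter_upwards [hρhat] with ω hω v hv hv1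
      have hD : Integrable fun x => kde K h (fun l => X l ω) x - W x :=
        hω.2.integrable.sub hW.integrable
      have hsa : IsSelfAdjoint ρ := hρ.pos.isSelfAdjoint
      have h1 := ofReal_integral_abs_le_traceNorm (hω.1.sub hsa) hD
        fun hfin t => IsTomogram.sub_fourier hω.1 hsa hρ.traceNorm_ne_top hω.2 hW hfin t
      have h2 : 2 * traceDist (ρhat ω) ρ = traceNorm (ρhat ω - ρ) :=
        ENNReal.mul_div_cancel (by norm_num) (by norm_num)
      rw [h2]
      refine le_trans (ENNReal.ofReal_le_ofReal ?_) h1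
      have i1 : Integrable fun x => kde K h (fun l => X l ω) x * v x :=
        hω.2.integrable.mul_bdd (c := 1) hv.aestronglyMeasurable (.of_forall hv1)
      have i2 : Integrable fun x => W x * v x :=
        hW.integrable.mul_bdd (c := 1) hv.aestronglyMeasurable (.of_forall hv1)
      rw [hK.mean_kernelAvg_eq_integral_kde hh _ hv hv1,
        integral_withDensity_ofReal hW.integrable.aemeasurable hW.nonneg, ← integral_sub i1 i2]
      refine abs_integral_le_integral_abs.trans
        (integral_mono (i1.sub i2).abs hD.abs fun x => ?_)
      simp only
      rw [← sub_mul, abs_mul]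
      exact mul_le_of_le_one_right (abs_nonneg _) (hv1 x))
  have hs : 0 < √ε := Real.sqrt_pos.2 hε
  have hpow : ε ^ (-(5 / 2) : ℝ) = (√ε ^ 5)⁻¹ := by
    rw [Real.rpow_neg hε.le, Real.sqrt_eq_rpow, ← Real.rpow_natCast, ← Real.rpow_mul hε.le]
    norm_num
  have hsqrt : √(2 * ε) ≤ 3 / 2 * √ε := by
    refine Real.sqrt_le_iff.2 ⟨by positivity, ?_⟩
    rw [mul_pow, Real.sq_sqrt hε.le]
    linarith
  have h5 : √(2 * ε) ^ 5 ≤ 8 * √ε ^ 5 := by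
    calc √(2 * ε) ^ 5 ≤ (3 / 2 * √ε) ^ 5 := by gcongr
      _ = (3 / 2) ^ 5 * √ε ^ 5 := mul_pow _ _ _
      _ ≤ 8 * √ε ^ 5 := by gcongr; norm_num
  rw [hpow, ← div_eq_mul_inv, div_le_iff₀ (by positivity), div_le_iff₀ (by norm_num)]
  calc (1 / 4096 : ℝ) ^ 5 ≤ n * √(2 * ε) ^ 5 := hcore
    _ ≤ n * (8 * √ε ^ 5) := by gcongr
    _ = n * √ε ^ 5 * 8 := by ring
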